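/- Let $n,d\ge 1$, let $f_1,\dots,f_n:\mathbb R^d\to\mathbb R$ be twice continuously differentiable, and let $x^\star$ be the minimizer of $\frac1n\sum_{i=1}^n f_i$. Let $\mu>0$, $L$, $\tilde L$ be such that for all $i$ and all $x,y\in\mathbb R^d$ $$\tfrac{\mu}{2}\|y-x\|^2\le f_i(y)-f_i(x)-\langle\nabla f_i(x),y-x\rangle\le\tfrac L2\|y-x\|^2,\qquad \|\nabla^2f_i(y)-\nabla^2f_i(x)\|\le\tilde L\|y-x\|,$$ with Euclidean norms of vectors and spectral norms of matrices. *Notation.* $X\succeq Y$ means that $X-Y$ is symmetric positive semidefinite. For $d\times d$ matrices $B,K$ put $\sigma(B,K)=\operatorname{Tr}\big((K^{-1})^{\mathsf T}(B-K)\big)$; for $u\in\mathbb R^d$ put $$\mathrm{BFGS}(B,K,u)=B-\frac{Buu^{\mathsf T}B}{\langle u,Bu\rangle}+\frac{Kuu^{\mathsf T}K}{\langle u,Ku\rangle}\quad(u\neq0),\qquad \mathrm{BFGS}(B,K,0)=B;$$ and let $\bar u(B,K)$ be any maximizer of $\langle u,Bu\rangle/\langle u,Ku\rangle$ over the standard basis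 vectors $u\in\{e_1,\dots,e_d\}$. For $t\ge1$ let $i_t=1+(t-1)\bmod n$. Put $M=\tilde L/\mu^{3/2}$. *Algorithm (SLIQN).* Given a sequence $(\alpha_k)_{k\ge0}$, a point $x^0$ and matrices $I_1^0,\dots,I_n^0$, set $z_i^0=x^0$ and $D_i^0=(1+\alpha_0)^2I_i^0$ for all $i$, and $\omega_t=(1+\alpha_{\lceil t/n\rceil})^2$ if $n\mid t$, $\omega_t=1$ otherwise. For $t\ge1$: $$x^t=\Big(\sum_{i=1}^nD_i^{t-1}\Big)^{-1}\sum_{i=1}^n\big(D_i^{t-1}z_i^{t-1}-\nabla f_i(z_i^{t-1})\big),$$ $z_{i_t}^t=x^t$; $z_i^t=z_i^{t-1}$ and $D_i^t=\omega_tD_i^{t-1}$ for $i\ne i_t$; and $$Q^t=\mathrm{BFGS}\big(D_{i_t}^{t-1},(1+\alpha_{\lceil t/n-1\rceil})K^t,z_{i_t}^t-z_{i_t}^{t-1}\big),\quad K^t=\int_0^1\nabla^2f_{i_t}\big(z_{i_t}^{t-1}+\tau(z_{i_t}^t-z_{i_t}^{t-1})\big)d\tau,$$ $$D_{i_t}^t=\omega_t\,\mathrm{BFGS}\big(Q^t,\nabla^2f_{i_t}(z_{i_t}^t),\bar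 u(Q^t,\nabla^2f_{i_t}(z_{i_t}^t))\big).$$ **Claim.** For every $\rho$ with $0<\rho<1-\frac{\mu}{dL}$ there exist $\epsilon>0$ and $\sigma_0>0$ such that the following holds. If $\|x^0-x^\star\|\le\epsilon$, and $I_i^0\succeq\nabla^2f_i(x^0)$ and $\sigma(I_i^0,\nabla^2f_i(x^0))\le\sigma_0$ for all $i$, then every sequence of iterates generated by the algorithm with $\alpha_k=M\sqrt L\,\epsilon\rho^k$ satisfies $$\|x^t-x^\star\|\le\rho^{\lceil t/n\rceil}\|x^0-x^\star\|\quad\text{for all }t\ge0,$$ and $$\sigma\big(\omega_t^{-1}D_{i_t}^t,\nabla^2f_{i_t}(z_{i_t}^t)\big)\le\Big(1-\frac{\mu}{dL}\Big)^{\lceil t/n\rceil}\delta\quad\text{for all }t\ge1,$$ where $$\delta=e^{\frac{4M\sqrt L\,\epsilon}{1-\rho}}\Big(\sigma_0+\epsilon\,\frac{4Md\sqrt L}{1-\frac{\rho}{1-\mu/(dL)}}\Big).$$ -/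

import Mathlib

open scoped Gradient

noncomputable section

namespace SLIQN

/-- The Hessian matrix of `f` at `x`, i.e. the matrix of second partial derivatives. -/
def hess {d : ℕ} (f : EuclideanSpace ℝ (Fin d) → ℝ) (x : EuclideanSpace ℝ (Fin d)) :
    Matrix (Fin d) (Fin d) ℝ :=
  Matrix.of fun i j =>
    fderiv ℝ (fderiv ℝ f) x (EuclideanSpace.single i 1) (EuclideanSpace.single j 1)

/-- The spectral norm of a matrix: the operator norm for the Euclidean norm. -/
def specNorm {d : ℕ} (A : Matrix (Fin d) (Fin d) ℝ) : ℝ :=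
  ‖Matrix.toEuclideanCLM (n := Fin d) (𝕜 := ℝ) A‖

/-- The product of a matrix with a vector of Euclidean space. -/
def app {d : ℕ} (A : Matrix (Fin d) (Fin d) ℝ) (v : EuclideanSpace ℝ (Fin d)) :
    EuclideanSpace ℝ (Fin d) :=
  Matrix.toEuclideanCLM (n := Fin d) (𝕜 := ℝ) A v

/-- `f` is `μ`-strongly convex and `L`-smooth on the whole space. -/
def StrongConvexSmooth {d : ℕ} (μ L : ℝ) (f : EuclideanSpace ℝ (Fin d) → ℝ) : Prop :=
  ∀ x y : EuclideanSpace ℝ (Fin d),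
    μ / 2 * ‖y - x‖ ^ 2 ≤ f y - f x - inner ℝ (∇ f x) (y - x) ∧
    f y - f x - inner ℝ (∇ f x) (y - x) ≤ L / 2 * ‖y - x‖ ^ 2

/-- The Hessian of `f` is `L'`-Lipschitz in the spectral norm. -/
def LipschitzHessian {d : ℕ} (L' : ℝ) (f : EuclideanSpace ℝ (Fin d) → ℝ) : Prop :=
  ∀ x y : EuclideanSpace ℝ (Fin d), specNorm (hess f y - hess f x) ≤ L' * ‖y - x‖

/-- The generalized BFGS update
`B - B u uᵀ B / ⟨u, B u⟩ + K u uᵀ K / ⟨u, K u⟩`. For `u = 0` both corrections vanish and the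
update leaves `B` unchanged. -/
def bfgs {d : ℕ} (B K : Matrix (Fin d) (Fin d) ℝ) (u : EuclideanSpace ℝ (Fin d)) :
    Matrix (Fin d) (Fin d) ℝ :=
  B - (inner ℝ u (app B u))⁻¹ • (B * Matrix.vecMulVec u u * B)
    + (inner ℝ u (app K u))⁻¹ • (K * Matrix.vecMulVec u u * K)

/-- `u` is a greedy vector of `B` with respect to `K`: a standard basis vector that maximizes
`⟨u, B u⟩ / ⟨u, K u⟩` among the standard basis vectors (ties are broken arbitrarily). -/
def IsGreedyVec {d : ℕ} (B K : Matrix (Fin d) (Fin d) ℝ) (u : EuclideanSpace ℝ (Fin d)) : Prop :=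
  ∃ i : Fin d, u = EuclideanSpace.single i 1 ∧
    ∀ v : EuclideanSpace ℝ (Fin d), (∃ j : Fin d, v = EuclideanSpace.single j 1) →
      inner ℝ v (app B v) / inner ℝ v (app K v) ≤ inner ℝ u (app B u) / inner ℝ u (app K u)

/-- The Hessian approximation error `σ(B, K) = ⟨K⁻¹, B - K⟩ = Tr((K⁻¹)ᵀ (B - K))`. -/
def sigma {d : ℕ} (B K : Matrix (Fin d) (Fin d) ℝ) : ℝ :=
  ((K⁻¹).transpose * (B - K)).trace

/-- The averaged Hessian `∫₀¹ ∇²f(a + τ (b - a)) dτ`, taken entrywise. -/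
def avgHess {d : ℕ} (f : EuclideanSpace ℝ (Fin d) → ℝ) (a b : EuclideanSpace ℝ (Fin d)) :
    Matrix (Fin d) (Fin d) ℝ :=
  Matrix.of fun i j => ∫ τ in (0 : ℝ)..1, hess f (a + τ • (b - a)) i j

/-- The cyclic index `i_t` for `t ≥ 1`. Indices run over `0, …, n - 1`, so it is
`(t - 1) mod n`. -/
def idx (n : ℕ) [NeZero n] (t : ℕ) : Fin n := Fin.ofNat n (t - 1)

/-- The scaling factor `ω_t`. -/
def omega (n : ℕ) (α : ℕ → ℝ) (t : ℕ) : ℝ :=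
  if n ∣ t then (1 + α ⌈(t : ℝ) / n⌉₊) ^ 2 else 1

/-- The matrix `Q^t`, obtained by the classical BFGS update in iteration `t ≥ 1`. -/
def classicUpdate {d n : ℕ} [NeZero n] (f : Fin n → EuclideanSpace ℝ (Fin d) → ℝ) (α : ℕ → ℝ)
    (z : ℕ → Fin n → EuclideanSpace ℝ (Fin d)) (D : ℕ → Fin n → Matrix (Fin d) (Fin d) ℝ)
    (t : ℕ) : Matrix (Fin d) (Fin d) ℝ :=
  bfgs (D (t - 1) (idx n t))
    ((1 + α ⌈(t : ℝ) / n - 1⌉₊) • avgHess (f (idx n t)) (z (t - 1) (idx n t)) (z t (idx n t)))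
    (z t (idx n t) - z (t - 1) (idx n t))

/-- `x`, `z`, `D` are the sequences generated by the sharpened lazy incremental quasi-Newton
algorithm with components `f`, scaling sequence `α`, starting point `x 0` and initial matrices
`I₀`. -/
structure IsRun {d n : ℕ} [NeZero n] (f : Fin n → EuclideanSpace ℝ (Fin d) → ℝ) (α : ℕ → ℝ)
    (I₀ : Fin n → Matrix (Fin d) (Fin d) ℝ) (x : ℕ → EuclideanSpace ℝ (Fin d))
    (z : ℕ → Fin n → EuclideanSpace ℝ (Fin d))
    (D : ℕ → Fin n → Matrix (Fin d) (Fin d) ℝ) : Prop where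
  z_zero : ∀ i, z 0 i = x 0
  D_zero : ∀ i, D 0 i = (1 + α 0) ^ 2 • I₀ i
  x_update : ∀ t, 1 ≤ t →
    x t = app (∑ i, D (t - 1) i)⁻¹
      (∑ i, (app (D (t - 1) i) (z (t - 1) i) - ∇ (f i) (z (t - 1) i)))
  z_update : ∀ t, 1 ≤ t → z t (idx n t) = x t
  z_keep : ∀ t, 1 ≤ t → ∀ i, i ≠ idx n t → z t i = z (t - 1) i
  D_keep : ∀ t, 1 ≤ t → ∀ i, i ≠ idx n t → D t i = omega n α t • D (t - 1) i
  D_update : ∀ t, 1 ≤ t → ∃ u : EuclideanSpace ℝ (Fin d),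
    IsGreedyVec (classicUpdate f α z D t) (hess (f (idx n t)) (z t (idx n t))) u ∧
    D t (idx n t) = omega n α t •
      bfgs (classicUpdate f α z D t) (hess (f (idx n t)) (z t (idx n t))) u

/-- The strong self-concordance parameter `M = L' / μ^{3/2}`. -/
def selfConc (μ L' : ℝ) : ℝ := L' / μ ^ (3 / 2 : ℝ)

/-- The scaling sequence `α_k = M √L ε ρ^k`. -/
def alpha (μ L L' ε ρ : ℝ) (k : ℕ) : ℝ := selfConc μ L' * √L * ε * ρ ^ k

/-- The constant `δ`. -/
def delta (d : ℕ) (μ L L' ε ρ σ₀ : ℝ) : ℝ :=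
  Real.exp (4 * selfConc μ L' * √L * ε / (1 - ρ)) *
    (σ₀ + ε * (4 * selfConc μ L' * d * √L / (1 - ρ / (1 - μ / (d * L)))))

end SLIQN

end

open scoped MatrixOrder
open Matrix

namespace SLIQN

/-! Write `H` for the Hessian of a component at its stored point. After `k` passes the component
carries `D = (1 + α k)² B` with `H ≤ B`, `σ(B, H) ≤ S k` and the stored point within `R k = ρ ^ k ‖x
0 - xstar‖` of `xstar`. This state (`PassInvariant`, `Tracks`) reproduces itself, because two
estimates support each other.

Points (`norm_step_sub_le`): since the gradients at `xstar` sum to zero, the new error is `(∑ D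
i)⁻¹` applied to the sum of `(D i - H i)(z i - xstar)` and of the linearization errors of the
gradients. Here `∑ D i ≥ n μ`, the norm of `D i - H i` is at most its trace, hence at most `L σ(D i,
H i)`, and the second part is at most `L' ‖z i - xstar‖²`. If `σ(D i, H i) ≤ s` for all `i` and `L s
+ L' ε ≤ ρ μ`, the error shrinks by `ρ`.

Matrices (`Tracks.update`): `α k` is large enough that `L' R k ≤ α k μ`, so the averaged Hessian `K`
and the Hessians at its two endpoints agree up to factors `1 + α k` in the Loewner order
(`hess_avgHess_le`). The scaling `(1 + α k)²` therefore puts `D` above `(1 + α k) K`, which lies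
above the new Hessian; BFGS updates preserve such upper bounds (`le_bfgs`). Changing targets costs
at most `(1 + α k)⁴` in the trace of `H⁻¹ B` (`le_and_sigma_bfgs_le`), and the greedy update
contracts `σ` by `c = 1 - μ / (d L)` (`sigma_bfgs_greedy_le`).

Unrolling `σ ↦ c ((1 + α k)⁴ (σ + d) - d)` yields `errorBound`, at most `c ^ k δ` by geometric
series; this is where `ρ < c` matters. As `δ` and `α 0` tend to `0` with `ε = σ₀`, the condition on
`s` holds for small `ε` (`exists_radius`). -/

theorem posDef_of_le {ι : Type*} {A B : Matrix ι ι ℝ} (hA : A.PosDef) (h : A ≤ B) : B.PosDef := by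
  have := hA.add_posSemidef (Matrix.le_iff.mp h)
  rwa [add_sub_cancel] at this

theorem matrix_smul_le_smul {ι : Type*} {A B : Matrix ι ι ℝ} (h : A ≤ B) {c : ℝ} (hc : 0 ≤ c) :
    c • A ≤ c • B := by
  rw [Matrix.le_iff, ← smul_sub]
  exact (Matrix.le_iff.mp h).smul hc

theorem le_smul_of_one_le {ι : Type*} {A : Matrix ι ι ℝ} (hA : A.PosSemidef) {c : ℝ} (hc : 1 ≤ c) :
    A ≤ c • A := by
  rw [Matrix.le_iff]
  have := hA.smul (sub_nonneg.2 hc)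
  rwa [sub_smul, one_smul] at this

/-! ### Quadratic forms, traces and the Loewner order -/

section QuadraticForms

variable {ι : Type*} [Fintype ι]

theorem dotProduct_mulVec_comm_of_isHermitian {A : Matrix ι ι ℝ} (hA : A.IsHermitian)
    (u v : ι → ℝ) : u ⬝ᵥ A *ᵥ v = v ⬝ᵥ A *ᵥ u := by
  have hT : Aᵀ = A := by simpa [conjTranspose_eq_transpose_of_trivial] using hA.eq
  rw [dotProduct_mulVec, ← mulVec_transpose, hT, dotProduct_comm]

theorem posSemidef_of_quadratic {A : Matrix ι ι ℝ} (hA : A.IsHermitian)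
    (h : ∀ v : ι → ℝ, 0 ≤ v ⬝ᵥ A *ᵥ v) : A.PosSemidef :=
  .of_dotProduct_mulVec_nonneg hA fun x => by simpa using h x

theorem quadratic_nonneg {A : Matrix ι ι ℝ} (hA : A.PosSemidef) (v : ι → ℝ) :
    0 ≤ v ⬝ᵥ A *ᵥ v := by
  simpa using hA.dotProduct_mulVec_nonneg v

theorem quadratic_pos {A : Matrix ι ι ℝ} (hA : A.PosDef) {v : ι → ℝ} (hv : v ≠ 0) :
    0 < v ⬝ᵥ A *ᵥ v := by
  simpa using hA.dotProduct_mulVec_pos hv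

/-- The Loewner order in terms of quadratic forms. -/
theorem matrix_le_of_quadratic {A B : Matrix ι ι ℝ} (hA : A.IsHermitian) (hB : B.IsHermitian)
    (h : ∀ v : ι → ℝ, v ⬝ᵥ A *ᵥ v ≤ v ⬝ᵥ B *ᵥ v) : A ≤ B := by
  rw [Matrix.le_iff]
  refine posSemidef_of_quadratic (hB.sub hA) fun v => ?_
  rw [sub_mulVec, dotProduct_sub]
  linarith [h v]

theorem quadratic_mono {A B : Matrix ι ι ℝ} (h : A ≤ B) (v : ι → ℝ) :
    v ⬝ᵥ A *ᵥ v ≤ v ⬝ᵥ B *ᵥ v := by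
  have := quadratic_nonneg (Matrix.le_iff.mp h) v
  rw [sub_mulVec, dotProduct_sub] at this
  linarith

theorem quadratic_sub_smul {A : Matrix ι ι ℝ} (hA : A.IsHermitian) (u v : ι → ℝ) (s : ℝ) :
    (v - s • u) ⬝ᵥ A *ᵥ (v - s • u) =
      v ⬝ᵥ A *ᵥ v - 2 * s * (v ⬝ᵥ A *ᵥ u) + s ^ 2 * (u ⬝ᵥ A *ᵥ u) := by
  simp only [mulVec_sub, mulVec_smul, dotProduct_sub, sub_dotProduct, dotProduct_smul,
    smul_dotProduct, smul_eq_mul, dotProduct_mulVec_comm_of_isHermitian hA u v]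
  ring

/-- The Cauchy–Schwarz inequality for a positive semidefinite quadratic form. -/
theorem sq_dotProduct_mulVec_le {A : Matrix ι ι ℝ} (hA : A.PosSemidef) (u v : ι → ℝ) :
    (v ⬝ᵥ A *ᵥ u) ^ 2 ≤ (v ⬝ᵥ A *ᵥ v) * (u ⬝ᵥ A *ᵥ u) := by
  have h := discrim_le_zero (a := u ⬝ᵥ A *ᵥ u) (b := -2 * (v ⬝ᵥ A *ᵥ u)) (c := v ⬝ᵥ A *ᵥ v)
    fun s => by
      have := quadratic_nonneg hA (v - s • u)
      rw [quadratic_sub_smul hA.isHermitian] at this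
      linarith
  rw [discrim] at h
  linarith

theorem trace_mul_vecMulVec (A : Matrix ι ι ℝ) (u v : ι → ℝ) :
    (A * vecMulVec u v).trace = v ⬝ᵥ A *ᵥ u := by
  rw [mul_vecMulVec, trace_vecMulVec, dotProduct_comm]

variable [DecidableEq ι]

/-- Factor `B = Cᴴ C`; by cyclicity the trace is that of `C A Cᴴ`. -/
theorem trace_mul_nonneg {A B : Matrix ι ι ℝ} (hA : A.PosSemidef) (hB : B.PosSemidef) :
    0 ≤ (A * B).trace := by
  obtain ⟨C, rfl⟩ := CStarAlgebra.nonneg_iff_eq_star_mul_self.mp hB.nonneg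
  rw [star_eq_conjTranspose]
  rw [← Matrix.mul_assoc, trace_mul_comm, ← Matrix.mul_assoc]
  exact (hA.mul_mul_conjTranspose_same C).trace_nonneg

theorem mulVec_inv_mulVec {A : Matrix ι ι ℝ} (hA : A.PosDef) (w : ι → ℝ) :
    A *ᵥ (A⁻¹ *ᵥ w) = w := by
  rw [mulVec_mulVec, mul_nonsing_inv _ ((isUnit_iff_isUnit_det A).1 hA.isUnit), one_mulVec]

/-- Inversion is antitone on positive definite matrices. -/
theorem inv_le_inv_of_posDef {A B : Matrix ι ι ℝ} (hA : A.PosDef) (h : A ≤ B) :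
    B⁻¹ ≤ A⁻¹ := by
  have hB := posDef_of_le hA h
  refine matrix_le_of_quadratic hB.inv.isHermitian hA.inv.isHermitian fun w => ?_
  -- Expand the `A`-form at `A⁻¹ w - B⁻¹ w`; its only term not involving an inverse form at `w` is
  -- `⟨B⁻¹ w, A B⁻¹ w⟩`, at most `⟨w, B⁻¹ w⟩` because `A ≤ B`.
  have h1 := quadratic_nonneg hA.posSemidef (A⁻¹ *ᵥ w - (1 : ℝ) • B⁻¹ *ᵥ w)
  rw [quadratic_sub_smul hA.isHermitian,
    dotProduct_mulVec_comm_of_isHermitian hA.isHermitian _ (B⁻¹ *ᵥ w), mulVec_inv_mulVec hA] at h1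
  have h2 := quadratic_mono h (B⁻¹ *ᵥ w)
  rw [mulVec_inv_mulVec hB] at h2
  rw [dotProduct_comm w, dotProduct_comm w]
  linarith

theorem trace_mul_le_trace_mul {A B C : Matrix ι ι ℝ} (h : A ≤ B) (hC : C.PosSemidef) :
    (A * C).trace ≤ (B * C).trace := by
  have := trace_mul_nonneg (Matrix.le_iff.mp h) hC
  rw [Matrix.sub_mul, trace_sub] at this
  linarith

theorem trace_inv_mul_le {A B C : Matrix ι ι ℝ} (hA : A.PosDef) (h : A ≤ B)
    (hC : C.PosSemidef) : (B⁻¹ * C).trace ≤ (A⁻¹ * C).trace :=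
  trace_mul_le_trace_mul (inv_le_inv_of_posDef hA h) hC

theorem inv_smul_matrix (A : Matrix ι ι ℝ) {c : ℝ} (hc : c ≠ 0) : (c • A)⁻¹ = c⁻¹ • A⁻¹ := by
  by_cases h : IsUnit A.det
  · let := invertibleOfNonzero hc
    rw [Matrix.inv_smul A c h, invOf_eq_inv]
  · have h' : ¬ IsUnit (c • A).det := by
      rw [det_smul, isUnit_iff_ne_zero] at *
      simp_all
    rw [nonsing_inv_apply_not_isUnit _ h, nonsing_inv_apply_not_isUnit _ h', smul_zero]

/-- Pair `v vᵀ ≤ ‖v‖² I`, which is Cauchy–Schwarz, with `A` under the trace. -/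
theorem dotProduct_le_trace {A : Matrix ι ι ℝ} (hA : A.PosSemidef) (v : ι → ℝ) :
    v ⬝ᵥ A *ᵥ v ≤ A.trace * (v ⬝ᵥ v) := by
  have h : vecMulVec v v ≤ (v ⬝ᵥ v) • (1 : Matrix ι ι ℝ) := by
    refine matrix_le_of_quadratic (by simpa using (posSemidef_vecMulVec_self_star v).isHermitian)
      (isHermitian_one.smul (IsSelfAdjoint.all _)) fun w => ?_
    have h1 := sq_dotProduct_mulVec_le (PosSemidef.one (n := ι) (R := ℝ)) v w
    simp only [one_mulVec] at h1
    simp only [vecMulVec_mulVec, dotProduct_smul, smul_mulVec, one_mulVec, smul_eq_mul,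
      dotProduct_comm v w, MulOpposite.smul_eq_mul_unop, MulOpposite.unop_op]
    linarith
  have := trace_mul_nonneg hA (Matrix.le_iff.mp h)
  rw [Matrix.mul_sub, trace_sub, trace_mul_vecMulVec, Matrix.mul_smul, trace_smul,
    Matrix.mul_one, smul_eq_mul] at this
  linarith

/-- Cauchy–Schwarz for the form of `A`, at `v` and `w = A v`, bounds `‖w‖⁴` by the product of two
forms, each controlled by the trace; then cancel `‖w‖²`. -/
theorem dotProduct_mulVec_self_le_trace_sq {A : Matrix ι ι ℝ} (hA : A.PosSemidef) (v : ι → ℝ) :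
    (A *ᵥ v) ⬝ᵥ (A *ᵥ v) ≤ A.trace ^ 2 * (v ⬝ᵥ v) := by
  set w := A *ᵥ v with hw
  have h1 := sq_dotProduct_mulVec_le hA v w
  have h2 := dotProduct_le_trace hA v
  have h3 := dotProduct_le_trace hA w
  rw [← hw] at h1
  have hw0 : 0 ≤ w ⬝ᵥ w := by simpa using dotProduct_star_self_nonneg w
  have hv0 := quadratic_nonneg hA v
  have h4 : (w ⬝ᵥ w) * (w ⬝ᵥ w) ≤ (A.trace ^ 2 * (v ⬝ᵥ v)) * (w ⬝ᵥ w) := by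
    calc _ = (w ⬝ᵥ w) ^ 2 := by ring
      _ ≤ _ := h1
      _ ≤ (A.trace * (w ⬝ᵥ w)) * (A.trace * (v ⬝ᵥ v)) := by
        exact mul_le_mul h3 (by rwa [← hw] at h2) (by rwa [← hw] at hv0)
          (mul_nonneg hA.trace_nonneg hw0)
      _ = _ := by ring
  rcases hw0.eq_or_lt with h0 | h0
  · rw [← h0]
    have : 0 ≤ v ⬝ᵥ v := by simpa using dotProduct_star_self_nonneg v
    positivity
  · exact le_of_mul_le_mul_right h4 h0

end QuadraticForms

/-! ### BFGS updates and the error `σ` -/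

section Update

variable {d : ℕ}

theorem inner_app (A : Matrix (Fin d) (Fin d) ℝ) (u v : EuclideanSpace ℝ (Fin d)) :
    inner ℝ u (app A v) = u.ofLp ⬝ᵥ A *ᵥ v.ofLp :=
  inner_toEuclideanCLM A u v

theorem mul_vecMulVec_mul_self {A : Matrix (Fin d) (Fin d) ℝ} (hA : A.IsHermitian)
    (u : Fin d → ℝ) : A * vecMulVec u u * A = vecMulVec (A *ᵥ u) (A *ᵥ u) := by
  have hT : Aᵀ = A := by simpa [conjTranspose_eq_transpose_of_trivial] using hA.eq
  rw [mul_vecMulVec, vecMulVec_mul, ← mulVec_transpose, hT]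

theorem isHermitian_vecMulVec_self (w : Fin d → ℝ) : (vecMulVec w w).IsHermitian := by
  simpa using (posSemidef_vecMulVec_self_star w).isHermitian

theorem quadratic_vecMulVec_self (w v : Fin d → ℝ) :
    v ⬝ᵥ vecMulVec w w *ᵥ v = (v ⬝ᵥ w) ^ 2 := by
  simp only [vecMulVec_mulVec, dotProduct_smul, dotProduct_comm w v,
    MulOpposite.smul_eq_mul_unop, MulOpposite.unop_op]
  ring

theorem bfgs_zero (B K : Matrix (Fin d) (Fin d) ℝ) : bfgs B K 0 = B := by
  simp [bfgs]

theorem bfgs_eq {B K : Matrix (Fin d) (Fin d) ℝ} (hB : B.IsHermitian) (hK : K.IsHermitian)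
    (u : EuclideanSpace ℝ (Fin d)) :
    bfgs B K u = B - (u.ofLp ⬝ᵥ B *ᵥ u.ofLp)⁻¹ • vecMulVec (B *ᵥ u.ofLp) (B *ᵥ u.ofLp)
      + (u.ofLp ⬝ᵥ K *ᵥ u.ofLp)⁻¹ • vecMulVec (K *ᵥ u.ofLp) (K *ᵥ u.ofLp) := by
  rw [bfgs, inner_app, inner_app, mul_vecMulVec_mul_self hB, mul_vecMulVec_mul_self hK]

theorem isHermitian_bfgs {B K : Matrix (Fin d) (Fin d) ℝ} (hB : B.IsHermitian)
    (hK : K.IsHermitian) (u : EuclideanSpace ℝ (Fin d)) : (bfgs B K u).IsHermitian := by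
  rw [bfgs_eq hB hK]
  exact (hB.sub ((isHermitian_vecMulVec_self _).smul (IsSelfAdjoint.all _))).add
    ((isHermitian_vecMulVec_self _).smul (IsSelfAdjoint.all _))

theorem ofLp_ne_zero {u : EuclideanSpace ℝ (Fin d)} (hu : u ≠ 0) : u.ofLp ≠ 0 := by
  simpa using hu

/-- The BFGS update keeps an upper approximation of its target an upper approximation. -/
theorem le_bfgs {B K : Matrix (Fin d) (Fin d) ℝ} (hK : K.PosDef) (h : K ≤ B)
    (u : EuclideanSpace ℝ (Fin d)) : K ≤ bfgs B K u := by
  rcases eq_or_ne u 0 with rfl | hu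
  · rwa [bfgs_zero]
  have hB := posDef_of_le hK h
  refine matrix_le_of_quadratic hK.isHermitian (isHermitian_bfgs hB.isHermitian hK.isHermitian u)
    fun v => ?_
  have hb := quadratic_pos hB (ofLp_ne_zero hu)
  have hk := quadratic_pos hK (ofLp_ne_zero hu)
  rw [bfgs_eq hB.isHermitian hK.isHermitian]
  simp only [add_mulVec, sub_mulVec, smul_mulVec, dotProduct_add, dotProduct_sub,
    dotProduct_smul, quadratic_vecMulVec_self, smul_eq_mul]
  set b := u.ofLp ⬝ᵥ B *ᵥ u.ofLp
  set k := u.ofLp ⬝ᵥ K *ᵥ u.ofLp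
  -- This `s` minimizes the `B`-form along `v - s u`, so the form of `B` minus its rank-one
  -- correction at `v` is the `B`-form at `v - s u`. Comparing with the `K`-form there leaves a
  -- perfect square.
  set s := b⁻¹ * (v ⬝ᵥ B *ᵥ u.ofLp) with hs
  have h1 := quadratic_mono h (v - s • u.ofLp)
  rw [quadratic_sub_smul hK.isHermitian, quadratic_sub_smul hB.isHermitian] at h1
  have e1 : v ⬝ᵥ B *ᵥ v - b⁻¹ * (v ⬝ᵥ B *ᵥ u.ofLp) ^ 2 =
      v ⬝ᵥ B *ᵥ v - 2 * s * (v ⬝ᵥ B *ᵥ u.ofLp) + s ^ 2 * b := by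
    rw [hs]; field_simp; ring
  have e2 : -2 * s * (v ⬝ᵥ K *ᵥ u.ofLp) + s ^ 2 * k + k⁻¹ * (v ⬝ᵥ K *ᵥ u.ofLp) ^ 2 =
      k⁻¹ * (s * k - v ⬝ᵥ K *ᵥ u.ofLp) ^ 2 := by
    field_simp; ring
  have e3 : 0 ≤ k⁻¹ * (s * k - v ⬝ᵥ K *ᵥ u.ofLp) ^ 2 := by positivity
  linarith

/-- The added rank-one term contributes exactly `1` to the trace. The removed one contributes `⟨Bu,
K⁻¹ Bu⟩ / ⟨u, Bu⟩`, at least `⟨u, Bu⟩ / ⟨u, Ku⟩` by Cauchy–Schwarz for `K`. -/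
theorem trace_inv_mul_bfgs_le {B K : Matrix (Fin d) (Fin d) ℝ} (hK : K.PosDef) (h : K ≤ B)
    {u : EuclideanSpace ℝ (Fin d)} (hu : u ≠ 0) :
    (K⁻¹ * bfgs B K u).trace ≤
      (K⁻¹ * B).trace - (inner ℝ u (app B u) / inner ℝ u (app K u) - 1) := by
  have hB := posDef_of_le hK h
  have hb := quadratic_pos hB (ofLp_ne_zero hu)
  have hk := quadratic_pos hK (ofLp_ne_zero hu)
  rw [bfgs_eq hB.isHermitian hK.isHermitian, inner_app, inner_app]
  have e1 : (K⁻¹ * vecMulVec (K *ᵥ u.ofLp) (K *ᵥ u.ofLp)).trace = u.ofLp ⬝ᵥ K *ᵥ u.ofLp := by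
    rw [trace_mul_vecMulVec, mulVec_mulVec,
      nonsing_inv_mul _ ((isUnit_iff_isUnit_det K).1 hK.isUnit), one_mulVec, dotProduct_comm]
  have e2 := sq_dotProduct_mulVec_le hK.posSemidef u.ofLp (K⁻¹ *ᵥ (B *ᵥ u.ofLp))
  rw [dotProduct_mulVec_comm_of_isHermitian hK.isHermitian _ u.ofLp, mulVec_inv_mulVec hK,
    dotProduct_comm (K⁻¹ *ᵥ _)] at e2
  rw [Matrix.mul_add, Matrix.mul_sub, trace_add, trace_sub, Matrix.mul_smul, Matrix.mul_smul,
    trace_smul, trace_smul, e1, trace_mul_vecMulVec, smul_eq_mul, smul_eq_mul,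
    inv_mul_cancel₀ hk.ne']
  set b := u.ofLp ⬝ᵥ B *ᵥ u.ofLp
  set k := u.ofLp ⬝ᵥ K *ᵥ u.ofLp
  set q := (B *ᵥ u.ofLp) ⬝ᵥ K⁻¹ *ᵥ B *ᵥ u.ofLp
  have e3 : b / k ≤ b⁻¹ * q := by
    rw [inv_mul_eq_div, div_le_div_iff₀ hk hb]
    nlinarith
  linarith

theorem sigma_eq_trace {B K : Matrix (Fin d) (Fin d) ℝ} (hK : K.PosDef) :
    sigma B K = (K⁻¹ * B).trace - d := by
  have hT : (K⁻¹)ᵀ = K⁻¹ := by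
    simpa [conjTranspose_eq_transpose_of_trivial] using hK.inv.isHermitian.eq
  rw [sigma, hT, Matrix.mul_sub, trace_sub,
    nonsing_inv_mul _ ((isUnit_iff_isUnit_det K).1 hK.isUnit), trace_one, Fintype.card_fin]

theorem sigma_eq_trace_sub {B K : Matrix (Fin d) (Fin d) ℝ} (hK : K.PosDef) :
    sigma B K = (K⁻¹ * (B - K)).trace := by
  have hT : (K⁻¹)ᵀ = K⁻¹ := by
    simpa [conjTranspose_eq_transpose_of_trivial] using hK.inv.isHermitian.eq
  rw [sigma, hT]

theorem sigma_nonneg {B K : Matrix (Fin d) (Fin d) ℝ} (hK : K.PosDef) (h : K ≤ B) :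
    0 ≤ sigma B K := by
  rw [sigma_eq_trace_sub hK]
  exact trace_mul_nonneg hK.inv.posSemidef (Matrix.le_iff.mp h)

theorem posDef_smul_one {c : ℝ} (hc : 0 < c) : (c • (1 : Matrix (Fin d) (Fin d) ℝ)).PosDef :=
  Matrix.PosDef.one.smul hc

/-- Inversion turns `μ I ≤ K` into `K⁻¹ ≤ μ⁻¹ I`, which is then paired with `B - K`. -/
theorem mul_sigma_le_trace_sub {μ : ℝ} (hμ : 0 < μ) {B K : Matrix (Fin d) (Fin d) ℝ}
    (hK : μ • 1 ≤ K) (h : K ≤ B) : μ * sigma B K ≤ (B - K).trace := by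
  have hKd := posDef_of_le (posDef_smul_one hμ) hK
  have := trace_inv_mul_le (posDef_smul_one hμ) hK (Matrix.le_iff.mp h)
  rw [inv_smul_matrix _ hμ.ne', inv_one, Matrix.smul_mul, Matrix.one_mul, trace_smul,
    smul_eq_mul, inv_mul_eq_div, le_div_iff₀ hμ, ← sigma_eq_trace_sub hKd] at this
  linarith

theorem trace_sub_le_mul_sigma {L : ℝ} (hL : 0 < L) {B K : Matrix (Fin d) (Fin d) ℝ}
    (hKd : K.PosDef) (hK : K ≤ L • 1) (h : K ≤ B) : (B - K).trace ≤ L * sigma B K := by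
  have := trace_inv_mul_le hKd hK (Matrix.le_iff.mp h)
  rw [inv_smul_matrix _ hL.ne', inv_one, Matrix.smul_mul, Matrix.one_mul, trace_smul,
    smul_eq_mul, inv_mul_eq_div, div_le_iff₀ hL, ← sigma_eq_trace_sub hKd] at this
  linarith

theorem inner_single_app (A : Matrix (Fin d) (Fin d) ℝ) (i : Fin d) :
    inner ℝ (EuclideanSpace.single i (1 : ℝ)) (app A (EuclideanSpace.single i 1)) = A i i := by
  simp [inner_app]

/-- A greedy BFGS update contracts the approximation error. -/
theorem sigma_bfgs_greedy_le {μ L : ℝ} (hμ : 0 < μ) (hL : 0 < L) (hd : 0 < d)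
    {B K : Matrix (Fin d) (Fin d) ℝ} (hμK : μ • 1 ≤ K) (hKL : K ≤ L • 1) (h : K ≤ B)
    {u : EuclideanSpace ℝ (Fin d)} (hu : IsGreedyVec B K u) :
    sigma (bfgs B K u) K ≤ (1 - μ / (d * L)) * sigma B K := by
  have hK := posDef_of_le (posDef_smul_one hμ) hμK
  obtain ⟨i, rfl, hmax⟩ := hu
  have hd' : (0 : ℝ) < d := by exact_mod_cast hd
  have h1 := trace_inv_mul_bfgs_le hK h
    (u := EuclideanSpace.single i 1) (by simp)
  rw [sigma_eq_trace hK]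
  have h0 := sigma_eq_trace (B := B) hK
  set r := inner ℝ (EuclideanSpace.single i (1 : ℝ)) (app B (EuclideanSpace.single i 1)) /
    inner ℝ (EuclideanSpace.single i (1 : ℝ)) (app K (EuclideanSpace.single i 1))
  -- Maximality of `r` gives `(B - K) j j ≤ (r - 1) K j j`, and diagonal entries of `K` are at most
  -- `L`. Summing over `j` bounds `μ σ` by `d L (r - 1)`, while the update lowers the trace by at
  -- least `r - 1`.
  have h2 : ∀ j, (B - K) j j ≤ L * (r - 1) := fun j => by
    have hj := hmax _ ⟨j, rfl⟩
    rw [inner_single_app, inner_single_app] at hj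
    have hKj : 0 < K j j := hK.diag_pos
    have hKL' := (Matrix.le_iff.mp hKL).diag_nonneg (i := j)
    have hBj := (Matrix.le_iff.mp h).diag_nonneg (i := j)
    simp only [Matrix.sub_apply, Matrix.smul_apply, one_apply_eq, smul_eq_mul, mul_one] at hKL' hBj ⊢
    have hr : B j j ≤ r * K j j := (div_le_iff₀ hKj).1 hj
    have hr1 : 0 ≤ r - 1 := by
      by_contra hneg
      nlinarith
    nlinarith
  have h3 : (B - K).trace ≤ d * (L * (r - 1)) := by
    calc (B - K).trace = ∑ j, (B - K) j j := rfl
      _ ≤ ∑ _j : Fin d, L * (r - 1) := Finset.sum_le_sum fun j _ => h2 j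
      _ = _ := by simp
  have h4 := mul_sigma_le_trace_sub hμ hμK h
  have h5 : μ / (d * L) * sigma B K ≤ r - 1 := by
    rw [div_mul_eq_mul_div, div_le_iff₀ (by positivity)]
    linarith
  linarith

/-- With `A = (1 + a) K` as target, `A ≤ (1 + a)² B`, so the update does not increase the trace
against `A⁻¹`. Passing from `H⁻¹` to `A⁻¹` is free by `H ≤ A`, and passing from `A⁻¹` to `H'⁻¹`
costs `(1 + a)²`; the scaling of `B` supplies the other `(1 + a)²`. -/
theorem le_and_sigma_bfgs_le {a : ℝ} (ha : 0 ≤ a) {B H H' K : Matrix (Fin d) (Fin d) ℝ}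
    (hH : H.PosDef) (hH' : H'.PosDef) (hK : K.PosDef) (hHB : H ≤ B)
    (hKH : K ≤ (1 + a) • H) (hHK : H ≤ (1 + a) • K)
    (hKH' : K ≤ (1 + a) • H') (hHK' : H' ≤ (1 + a) • K) (u : EuclideanSpace ℝ (Fin d)) :
    H' ≤ bfgs ((1 + a) ^ 2 • B) ((1 + a) • K) u ∧
      sigma (bfgs ((1 + a) ^ 2 • B) ((1 + a) • K) u) H' ≤
        (1 + a) ^ 4 * (sigma B H + d) - d := by
  have ha1 : 0 < 1 + a := by linarith
  have hA : ((1 + a) • K).PosDef := hK.smul ha1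
  have hAB : (1 + a) • K ≤ (1 + a) ^ 2 • B := by
    refine (matrix_smul_le_smul hKH ha1.le).trans ?_
    rw [smul_smul, ← pow_two]
    exact matrix_smul_le_smul hHB (by positivity)
  have hle := le_bfgs hA hAB u
  refine ⟨hHK'.trans hle, ?_⟩
  rw [sigma_eq_trace hH', sigma_eq_trace hH, sub_add_cancel]
  have hB : (B).PosSemidef := (posDef_of_le hH hHB).posSemidef
  have h1 : (((1 + a) • K)⁻¹ * bfgs ((1 + a) ^ 2 • B) ((1 + a) • K) u).trace ≤
      (((1 + a) • K)⁻¹ * ((1 + a) ^ 2 • B)).trace := by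
    -- The case `u = 0` occurs when the new point coincides with the stored one.
    rcases eq_or_ne u 0 with rfl | hu
    · rw [bfgs_zero]
    have := trace_inv_mul_bfgs_le hA hAB hu
    have hu' : 1 ≤ inner ℝ u (app ((1 + a) ^ 2 • B) u) / inner ℝ u (app ((1 + a) • K) u) := by
      rw [inner_app, inner_app, one_le_div (quadratic_pos hA (ofLp_ne_zero hu))]
      exact quadratic_mono hAB _
    linarith
  have h2 : (((1 + a) • K)⁻¹ * ((1 + a) ^ 2 • B)).trace ≤ (1 + a) ^ 2 * (H⁻¹ * B).trace := by
    rw [Matrix.mul_smul, trace_smul, smul_eq_mul]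
    exact mul_le_mul_of_nonneg_left (trace_inv_mul_le hH hHK hB) (by positivity)
  set Q := bfgs ((1 + a) ^ 2 • B) ((1 + a) • K) u
  have hQ : Q.PosSemidef := (posDef_of_le hA hle).posSemidef
  have h3 : (H'⁻¹ * Q).trace ≤ (1 + a) ^ 2 * (((1 + a) • K)⁻¹ * Q).trace := by
    have hAH : (1 + a) • K ≤ (1 + a) ^ 2 • H' := by
      have := matrix_smul_le_smul hKH' ha1.le
      rwa [smul_smul, ← pow_two] at this
    have := trace_inv_mul_le hA hAH hQ
    rw [inv_smul_matrix _ (by positivity), Matrix.smul_mul, trace_smul, smul_eq_mul,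
      inv_mul_eq_div, div_le_iff₀ (by positivity)] at this
    linarith
  have h4 : (1 + a) ^ 2 * (((1 + a) • K)⁻¹ * Q).trace ≤
      (1 + a) ^ 2 * ((1 + a) ^ 2 * (H⁻¹ * B).trace) :=
    mul_le_mul_of_nonneg_left (h1.trans h2) (by positivity)
  linarith

theorem norm_app_le_trace {P : Matrix (Fin d) (Fin d) ℝ} (hP : P.PosSemidef)
    (v : EuclideanSpace ℝ (Fin d)) : ‖app P v‖ ≤ P.trace * ‖v‖ := by
  have h := dotProduct_mulVec_self_le_trace_sq hP v.ofLp
  have e : ∀ w : EuclideanSpace ℝ (Fin d), w.ofLp ⬝ᵥ w.ofLp = ‖w‖ ^ 2 := fun w => by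
    rw [EuclideanSpace.real_norm_sq_eq, dotProduct]
    exact Finset.sum_congr rfl fun i _ => (pow_two _).symm
  have h' : ‖app P v‖ ^ 2 ≤ (P.trace * ‖v‖) ^ 2 := by
    rw [mul_pow, ← e, ← e]; exact h
  exact (sq_le_sq₀ (norm_nonneg _) (mul_nonneg hP.trace_nonneg (norm_nonneg _))).1 h'

theorem quadratic_smul_one (c : ℝ) (v : EuclideanSpace ℝ (Fin d)) :
    v.ofLp ⬝ᵥ (c • (1 : Matrix (Fin d) (Fin d) ℝ)) *ᵥ v.ofLp = c * ‖v‖ ^ 2 := by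
  rw [smul_mulVec, one_mulVec, dotProduct_smul, smul_eq_mul, EuclideanSpace.real_norm_sq_eq,
    dotProduct]
  simp only [pow_two]

theorem app_inv_app {A : Matrix (Fin d) (Fin d) ℝ} (hA : A.PosDef)
    (w : EuclideanSpace ℝ (Fin d)) : app A (app A⁻¹ w) = w := by
  have := mulVec_inv_mulVec hA w.ofLp
  exact congrArg (WithLp.toLp 2) this

theorem app_inv_self {A : Matrix (Fin d) (Fin d) ℝ} (hA : A.PosDef)
    (w : EuclideanSpace ℝ (Fin d)) : app A⁻¹ (app A w) = w := by
  have : A⁻¹ *ᵥ (A *ᵥ w.ofLp) = w.ofLp := by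
    rw [mulVec_mulVec, nonsing_inv_mul _ ((isUnit_iff_isUnit_det A).1 hA.isUnit), one_mulVec]
  exact congrArg (WithLp.toLp 2) this

theorem mul_norm_app_inv_le {c : ℝ} (hc : 0 < c) {A : Matrix (Fin d) (Fin d) ℝ}
    (hA : c • 1 ≤ A) (w : EuclideanSpace ℝ (Fin d)) : c * ‖app A⁻¹ w‖ ≤ ‖w‖ := by
  have h := quadratic_mono hA (app A⁻¹ w).ofLp
  rw [quadratic_smul_one, ← inner_app, app_inv_app (posDef_of_le (posDef_smul_one hc) hA)] at h
  have h' := real_inner_le_norm (app A⁻¹ w) w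
  rcases (norm_nonneg (app A⁻¹ w)).eq_or_lt with h0 | h0
  · rw [← h0]; simp
  · refine le_of_mul_le_mul_left ?_ h0
    linarith

end Update

/-! ### Bounds on Hessians and averaged Hessians -/

section Hessian

variable {d : ℕ} {f : EuclideanSpace ℝ (Fin d) → ℝ}

theorem sum_smul_single (u : EuclideanSpace ℝ (Fin d)) :
    ∑ i, u i • EuclideanSpace.single i (1 : ℝ) = u := by
  simpa using (EuclideanSpace.basisFun (Fin d) ℝ).sum_repr u

theorem dotProduct_hess_mulVec (x u v : EuclideanSpace ℝ (Fin d)) :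
    u.ofLp ⬝ᵥ hess f x *ᵥ v.ofLp = fderiv ℝ (fderiv ℝ f) x u v := by
  conv_rhs => rw [← sum_smul_single u, ← sum_smul_single v]
  simp only [map_sum, map_smul, _root_.sum_apply, _root_.smul_apply,
    dotProduct, mulVec, hess, of_apply, smul_eq_mul, Finset.mul_sum]
  rw [Finset.sum_comm]
  refine Finset.sum_congr rfl fun i _ => Finset.sum_congr rfl fun j _ => by ring

theorem isSymm_fderiv_fderiv (hf : ContDiff ℝ 2 f) (x u v : EuclideanSpace ℝ (Fin d)) :
    fderiv ℝ (fderiv ℝ f) x u v = fderiv ℝ (fderiv ℝ f) x v u :=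
  (hf.contDiffAt.isSymmSndFDerivAt (by simp)) u v

theorem isHermitian_hess (hf : ContDiff ℝ 2 f) (x : EuclideanSpace ℝ (Fin d)) :
    (hess f x).IsHermitian := by
  ext i j
  simpa [hess] using isSymm_fderiv_fderiv hf x _ _

theorem differentiable_fderiv (hf : ContDiff ℝ 2 f) : Differentiable ℝ (fderiv ℝ f) :=
  (hf.fderiv_right (m := 1) (by norm_num)).differentiable (by norm_num)

theorem continuous_fderiv_fderiv (hf : ContDiff ℝ 2 f) :
    Continuous (fderiv ℝ (fderiv ℝ f)) :=
  (hf.fderiv_right (m := 1) (by norm_num)).continuous_fderiv (by norm_num)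

theorem fderiv_fderiv_mem_Icc {μ L : ℝ} (hf : ContDiff ℝ 2 f) (h : StrongConvexSmooth μ L f)
    (x v : EuclideanSpace ℝ (Fin d)) :
    fderiv ℝ (fderiv ℝ f) x v v ∈ Set.Icc (μ * ‖v‖ ^ 2) (L * ‖v‖ ^ 2) := by
  have hline : HasDerivAt (fun s : ℝ => x + s • v) v 0 := by
    simpa using ((hasDerivAt_id (0 : ℝ)).smul_const v).const_add x
  have hD : HasDerivAt (fun s : ℝ => fderiv ℝ f (x + s • v) v)
      (fderiv ℝ (fderiv ℝ f) x v v) 0 := by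
    have h1 : HasFDerivAt (fderiv ℝ f) (fderiv ℝ (fderiv ℝ f) x) (x + (0 : ℝ) • v) := by
      simpa using (differentiable_fderiv hf x).hasFDerivAt
    have h2 : HasDerivAt (fun s : ℝ => fderiv ℝ f (x + s • v)) (fderiv ℝ (fderiv ℝ f) x v) 0 :=
      h1.comp_hasDerivAt 0 hline
    simpa using h2.clm_apply (hasDerivAt_const (0 : ℝ) v)
  have hlim := hD.tendsto_slope
  refine isClosed_Icc.mem_of_tendsto hlim ?_
  filter_upwards [self_mem_nhdsWithin] with s hs
  have hs0 : s ≠ 0 := hs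
  -- Adding the inequalities for both orders of the two points eliminates the function values and
  -- leaves bounds on the increment of the derivative. Division by `s ^ 2` below avoids cases on the
  -- sign of `s`.
  obtain ⟨l1, u1⟩ := h x (x + s • v)
  obtain ⟨l2, u2⟩ := h (x + s • v) x
  have e1 : x + s • v - x = s • v := by abel
  have e2 : x - (x + s • v) = -(s • v) := by abel
  rw [e1, inner_gradient_left, norm_smul, map_smul] at l1 u1
  rw [e2, inner_gradient_left, norm_neg, norm_smul, map_neg, map_smul] at l2 u2
  rw [mul_pow, Real.norm_eq_abs, sq_abs, smul_eq_mul] at l1 u1 l2 u2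
  rw [slope_def_field, zero_smul, add_zero, sub_zero]
  have e3 : (fderiv ℝ f (x + s • v) v - fderiv ℝ f x v) / s =
      (s * fderiv ℝ f (x + s • v) v - s * fderiv ℝ f x v) / s ^ 2 := by
    field_simp
  rw [e3]
  have hs2 : 0 < s ^ 2 := by positivity
  exact ⟨by rw [le_div_iff₀ hs2]; linarith, by rw [div_le_iff₀ hs2]; linarith⟩

theorem isHermitian_smul_one (c : ℝ) : (c • (1 : Matrix (Fin d) (Fin d) ℝ)).IsHermitian :=
  isHermitian_one.smul (IsSelfAdjoint.all _)

theorem smul_one_le_of_quadratic {c : ℝ} {A : Matrix (Fin d) (Fin d) ℝ} (hA : A.IsHermitian)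
    (h : ∀ v : EuclideanSpace ℝ (Fin d), c * ‖v‖ ^ 2 ≤ v.ofLp ⬝ᵥ A *ᵥ v.ofLp) : c • 1 ≤ A :=
  matrix_le_of_quadratic (isHermitian_smul_one c) hA fun v => by
    have := h (WithLp.toLp 2 v)
    rwa [← quadratic_smul_one] at this

theorem le_smul_one_of_quadratic {c : ℝ} {A : Matrix (Fin d) (Fin d) ℝ} (hA : A.IsHermitian)
    (h : ∀ v : EuclideanSpace ℝ (Fin d), v.ofLp ⬝ᵥ A *ᵥ v.ofLp ≤ c * ‖v‖ ^ 2) : A ≤ c • 1 :=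
  matrix_le_of_quadratic hA (isHermitian_smul_one c) fun v => by
    have := h (WithLp.toLp 2 v)
    rwa [← quadratic_smul_one] at this

theorem smul_one_le_hess {μ L : ℝ} (hf : ContDiff ℝ 2 f) (h : StrongConvexSmooth μ L f)
    (x : EuclideanSpace ℝ (Fin d)) : μ • 1 ≤ hess f x :=
  smul_one_le_of_quadratic (isHermitian_hess hf x) fun v => by
    rw [dotProduct_hess_mulVec]; exact (fderiv_fderiv_mem_Icc hf h x v).1

theorem hess_le_smul_one {μ L : ℝ} (hf : ContDiff ℝ 2 f) (h : StrongConvexSmooth μ L f)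
    (x : EuclideanSpace ℝ (Fin d)) : hess f x ≤ L • 1 :=
  le_smul_one_of_quadratic (isHermitian_hess hf x) fun v => by
    rw [dotProduct_hess_mulVec]; exact (fderiv_fderiv_mem_Icc hf h x v).2

theorem abs_fderiv_fderiv_sub_le {L' : ℝ} (h : LipschitzHessian L' f)
    (x y u v : EuclideanSpace ℝ (Fin d)) :
    |fderiv ℝ (fderiv ℝ f) y u v - fderiv ℝ (fderiv ℝ f) x u v| ≤
      L' * ‖y - x‖ * ‖u‖ * ‖v‖ := by
  have e : fderiv ℝ (fderiv ℝ f) y u v - fderiv ℝ (fderiv ℝ f) x u v =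
      inner ℝ u (app (hess f y - hess f x) v) := by
    rw [inner_app, sub_mulVec, dotProduct_sub, dotProduct_hess_mulVec, dotProduct_hess_mulVec]
  rw [e]
  calc |inner ℝ u (app (hess f y - hess f x) v)|
      ≤ ‖u‖ * ‖app (hess f y - hess f x) v‖ := abs_real_inner_le_norm _ _
    _ ≤ ‖u‖ * (specNorm (hess f y - hess f x) * ‖v‖) := by
      gcongr; exact ContinuousLinearMap.le_opNorm _ _
    _ ≤ ‖u‖ * (L' * ‖y - x‖ * ‖v‖) := by gcongr; exact h x y
    _ = _ := by ring

theorem norm_fderiv_fderiv_sub_le {L' : ℝ} (hL' : 0 ≤ L') (h : LipschitzHessian L' f)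
    (x y : EuclideanSpace ℝ (Fin d)) :
    ‖fderiv ℝ (fderiv ℝ f) y - fderiv ℝ (fderiv ℝ f) x‖ ≤ L' * ‖y - x‖ :=
  ContinuousLinearMap.opNorm_le_bound₂ _ (by positivity) fun u v => by
    simpa using abs_fderiv_fderiv_sub_le h x y u v

/-- The gradient is well approximated by its linearization. -/
theorem norm_app_hess_sub_gradient_le {L' : ℝ} (hL' : 0 ≤ L') (hf : ContDiff ℝ 2 f)
    (h : LipschitzHessian L' f) (x y : EuclideanSpace ℝ (Fin d)) :
    ‖app (hess f y) (y - x) - (∇ f y - ∇ f x)‖ ≤ L' * ‖y - x‖ ^ 2 := by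
  -- The mean value inequality gives `L'` instead of the sharp `L' / 2`; this is harmless since `ε`
  -- is free.
  have hmv : ‖fderiv ℝ f y - fderiv ℝ f x - fderiv ℝ (fderiv ℝ f) y (y - x)‖ ≤
      (L' * ‖y - x‖) * ‖y - x‖ := by
    refine (convex_segment x y).norm_image_sub_le_of_norm_hasFDerivWithin_le'
      (f' := fderiv ℝ (fderiv ℝ f))
      (fun w _ => (differentiable_fderiv hf w).hasFDerivAt.hasFDerivWithinAt) (fun w hw => ?_)
      (left_mem_segment ℝ x y) (right_mem_segment ℝ x y)
    refine (norm_fderiv_fderiv_sub_le hL' h y w).trans ?_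
    gcongr
    rw [norm_sub_rev y x]
    exact norm_sub_le_of_mem_segment (segment_symm ℝ x y ▸ hw)
  set g := app (hess f y) (y - x) - (∇ f y - ∇ f x) with hg
  have e : ‖g‖ ^ 2 = -((fderiv ℝ f y - fderiv ℝ f x - fderiv ℝ (fderiv ℝ f) y (y - x)) g) := by
    rw [← real_inner_self_eq_norm_sq]
    nth_rewrite 2 [hg]
    rw [inner_sub_right, inner_sub_right, inner_app, dotProduct_hess_mulVec,
      isSymm_fderiv_fderiv hf, real_inner_comm, real_inner_comm (∇ f x), inner_gradient_left,
      inner_gradient_left]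
    simp only [_root_.sub_apply]
    ring
  have h1 : ‖g‖ ^ 2 ≤ (L' * ‖y - x‖ * ‖y - x‖) * ‖g‖ := by
    rw [e]
    refine (neg_le_abs _).trans (le_trans (ContinuousLinearMap.le_opNorm
      (fderiv ℝ f y - fderiv ℝ f x - fderiv ℝ (fderiv ℝ f) y (y - x)) g) ?_)
    gcongr
  rcases (norm_nonneg g).eq_or_lt with h0 | h0
  · rw [← h0]; positivity
  · refine le_of_mul_le_mul_right ?_ h0
    linarith

theorem lipschitzHessian_nonneg (hd : 0 < d) {L' : ℝ} (h : LipschitzHessian L' f) : 0 ≤ L' := by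
  have := h 0 (EuclideanSpace.single ⟨0, hd⟩ 1)
  simp only [sub_zero, PiLp.norm_single, norm_one, mul_one] at this
  exact (norm_nonneg _).trans this

theorem strongConvexSmooth_le (hd : 0 < d) {μ L : ℝ} (h : StrongConvexSmooth μ L f) : μ ≤ L := by
  have := h 0 (EuclideanSpace.single ⟨0, hd⟩ 1)
  simp only [sub_zero, PiLp.norm_single, norm_one, one_pow, mul_one] at this
  linarith

theorem continuous_hess_line (hf : ContDiff ℝ 2 f) (a b u v : EuclideanSpace ℝ (Fin d)) :
    Continuous fun τ : ℝ => fderiv ℝ (fderiv ℝ f) (a + τ • (b - a)) u v := by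
  have := (continuous_fderiv_fderiv hf).comp
    (show Continuous fun τ : ℝ => a + τ • (b - a) by fun_prop)
  exact (this.clm_apply continuous_const).clm_apply continuous_const

theorem quadratic_avgHess (hf : ContDiff ℝ 2 f) (a b v : EuclideanSpace ℝ (Fin d)) :
    v.ofLp ⬝ᵥ avgHess f a b *ᵥ v.ofLp =
      ∫ τ in (0 : ℝ)..1, fderiv ℝ (fderiv ℝ f) (a + τ • (b - a)) v v := by
  simp only [← dotProduct_hess_mulVec, dotProduct, mulVec, Finset.mul_sum]
  have hc : ∀ i j, Continuous fun τ : ℝ => v i * (hess f (a + τ • (b - a)) i j * v j) :=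
    fun i j => continuous_const.mul ((continuous_hess_line hf a b _ _).mul continuous_const)
  rw [intervalIntegral.integral_finsetSum fun i _ =>
    (continuous_finsetSum _ fun j _ => hc i j).intervalIntegrable _ _]
  refine Finset.sum_congr rfl fun i _ => ?_
  rw [intervalIntegral.integral_finsetSum fun j _ => (hc i j).intervalIntegrable _ _]
  refine Finset.sum_congr rfl fun j _ => ?_
  rw [intervalIntegral.integral_const_mul, intervalIntegral.integral_mul_const]
  rfl

theorem avgHess_comm (a b : EuclideanSpace ℝ (Fin d)) : avgHess f a b = avgHess f b a := by
  ext i j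
  have := intervalIntegral.integral_comp_sub_left (a := 0) (b := 1)
    (fun τ : ℝ => hess f (a + τ • (b - a)) i j) 1
  simp only [sub_zero, sub_self] at this
  simp only [avgHess, of_apply]
  rw [← this]
  refine intervalIntegral.integral_congr fun τ _ => ?_
  have : a + (1 - τ) • (b - a) = b + τ • (a - b) := by module
  simp only [this]

theorem isHermitian_avgHess (hf : ContDiff ℝ 2 f) (a b : EuclideanSpace ℝ (Fin d)) :
    (avgHess f a b).IsHermitian := by
  ext i j
  simp only [conjTranspose_apply, avgHess, of_apply, star_trivial]
  exact intervalIntegral.integral_congr fun τ _ => isSymm_fderiv_fderiv hf _ _ _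

theorem smul_one_le_avgHess {μ L : ℝ} (hf : ContDiff ℝ 2 f) (h : StrongConvexSmooth μ L f)
    (a b : EuclideanSpace ℝ (Fin d)) : μ • 1 ≤ avgHess f a b :=
  smul_one_le_of_quadratic (isHermitian_avgHess hf a b) fun v => by
    rw [quadratic_avgHess hf]
    have := intervalIntegral.integral_mono_on (μ := MeasureTheory.volume) zero_le_one
      (intervalIntegrable_const (c := μ * ‖v‖ ^ 2))
      ((continuous_hess_line hf a b v v).intervalIntegrable 0 1)
      fun τ _ => (fderiv_fderiv_mem_Icc hf h _ v).1
    simpa using this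

/-- The factor `1 / 2` is `∫ τ`; it later cancels the `2` in the distance `2 r` between consecutive
points. -/
theorem abs_quadratic_avgHess_sub_le {L' : ℝ} (hf : ContDiff ℝ 2 f) (h : LipschitzHessian L' f)
    (a b v : EuclideanSpace ℝ (Fin d)) :
    |v.ofLp ⬝ᵥ avgHess f a b *ᵥ v.ofLp - v.ofLp ⬝ᵥ hess f a *ᵥ v.ofLp| ≤
      L' * ‖b - a‖ / 2 * ‖v‖ ^ 2 := by
  have hc := (continuous_hess_line hf a b v v).intervalIntegrable (μ := MeasureTheory.volume) 0 1
  have e : v.ofLp ⬝ᵥ avgHess f a b *ᵥ v.ofLp - v.ofLp ⬝ᵥ hess f a *ᵥ v.ofLp =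
      ∫ τ in (0 : ℝ)..1, (fderiv ℝ (fderiv ℝ f) (a + τ • (b - a)) v v -
        fderiv ℝ (fderiv ℝ f) a v v) := by
    rw [intervalIntegral.integral_sub hc (by simp), quadratic_avgHess hf, dotProduct_hess_mulVec]
    simp
  have hb : ∫ τ in (0 : ℝ)..1, L' * ‖b - a‖ * ‖v‖ ^ 2 * τ = L' * ‖b - a‖ / 2 * ‖v‖ ^ 2 := by
    rw [intervalIntegral.integral_const_mul, integral_id]
    ring
  rw [e, ← hb, ← Real.norm_eq_abs]
  refine intervalIntegral.norm_integral_le_of_norm_le zero_le_one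
    (Filter.Eventually.of_forall fun τ hτ => ?_) (Continuous.intervalIntegrable (by fun_prop) _ _)
  have := abs_fderiv_fderiv_sub_le h a (a + τ • (b - a)) v v
  rw [add_sub_cancel_left, norm_smul, Real.norm_eq_abs, abs_of_pos hτ.1] at this
  rw [Real.norm_eq_abs]
  linarith

/-- The two forms differ by at most `c μ ‖v‖²`, and each of them dominates `μ ‖v‖²`, so the
difference is absorbed by a factor `1 + c` on either side. -/
theorem hess_avgHess_le {μ L L' c : ℝ} (hf : ContDiff ℝ 2 f)
    (hconv : StrongConvexSmooth μ L f) (hlip : LipschitzHessian L' f) (hc0 : 0 ≤ c)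
    (a b : EuclideanSpace ℝ (Fin d)) (hc : L' * ‖b - a‖ / 2 ≤ c * μ) :
    avgHess f a b ≤ (1 + c) • hess f a ∧ hess f a ≤ (1 + c) • avgHess f a b := by
  have hH := isHermitian_hess hf a
  have hK := isHermitian_avgHess hf a b
  have key : ∀ v : Fin d → ℝ, |v ⬝ᵥ avgHess f a b *ᵥ v - v ⬝ᵥ hess f a *ᵥ v| ≤
      c * (μ * ‖WithLp.toLp 2 v‖ ^ 2) := fun v =>
    (abs_quadratic_avgHess_sub_le hf hlip a b (WithLp.toLp 2 v)).trans <| by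
      rw [← mul_assoc]; gcongr
  constructor
  · refine matrix_le_of_quadratic hK (hH.smul (IsSelfAdjoint.all _)) fun v => ?_
    have h1 := quadratic_mono (smul_one_le_hess hf hconv a) v
    rw [quadratic_smul_one μ (WithLp.toLp 2 v)] at h1
    have h2 := (abs_le.1 (key v)).2
    have h3 := mul_le_mul_of_nonneg_left h1 hc0
    rw [smul_mulVec, dotProduct_smul, smul_eq_mul]
    linarith
  · refine matrix_le_of_quadratic hH (hK.smul (IsSelfAdjoint.all _)) fun v => ?_
    have h1 := quadratic_mono (smul_one_le_avgHess hf hconv a b) v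
    rw [quadratic_smul_one μ (WithLp.toLp 2 v)] at h1
    have h2 := (abs_le.1 (key v)).1
    have h3 := mul_le_mul_of_nonneg_left h1 hc0
    rw [smul_mulVec, dotProduct_smul, smul_eq_mul]
    linarith

theorem sum_gradient_eq_zero {n : ℕ} [NeZero n] {f : Fin n → EuclideanSpace ℝ (Fin d) → ℝ}
    (hf : ∀ i, ContDiff ℝ 2 (f i)) {x : EuclideanSpace ℝ (Fin d)}
    (hx : IsMinOn (fun y => (1 / (n : ℝ)) * ∑ i, f i y) Set.univ x) : ∑ i, ∇ (f i) x = 0 := by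
  have hn : (0 : ℝ) < n := by exact_mod_cast NeZero.pos n
  have hmin : IsLocalMin (fun y => ∑ i, f i y) x := Filter.Eventually.of_forall fun y => by
    have := hx (Set.mem_univ y)
    exact le_of_mul_le_mul_left this (by positivity)
  have hd : ∀ i ∈ Finset.univ, HasFDerivAt (f i) (fderiv ℝ (f i) x) x := fun i _ =>
    ((hf i).differentiable (by norm_num) x).hasFDerivAt
  have h0 := hmin.hasFDerivAt_eq_zero (HasFDerivAt.fun_sum hd)
  refine ext_inner_right ℝ fun v => ?_
  rw [sum_inner, inner_zero_left]
  simp only [inner_gradient_left]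
  simpa using congrArg (fun g => g v) h0

end Hessian

/-! ### Passes and positions within a pass -/

section Counting

variable {n : ℕ}

theorem ceil_succ_div [NeZero n] (t : ℕ) : ⌈((t + 1 : ℕ) : ℝ) / n⌉₊ = t / n + 1 := by
  have hn : 0 < n := NeZero.pos n
  have hn' : (0 : ℝ) < n := by exact_mod_cast hn
  rw [Nat.ceil_eq_iff (Nat.succ_ne_zero _), Nat.succ_sub_one, lt_div_iff₀ hn', div_le_iff₀ hn']
  constructor
  · exact_mod_cast Nat.lt_succ_of_le (Nat.div_mul_le_self t n)
  · exact_mod_cast Nat.succ_le_of_lt ((Nat.div_lt_iff_lt_mul hn).1 (Nat.lt_succ_self (t / n)))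

theorem idx_succ_val [NeZero n] (t : ℕ) : (idx n (t + 1)).val = t % n := rfl

theorem mod_succ_of_not_dvd {t : ℕ} (h : ¬ n ∣ t + 1) : (t + 1) % n = t % n + 1 := by
  have h1 : (t + 1) / n = t / n := by rw [Nat.succ_div, if_neg h, add_zero]
  have h2 := Nat.div_add_mod (t + 1) n
  have h3 := Nat.div_add_mod t n
  rw [h1] at h2
  omega

theorem mod_add_one_of_dvd {t : ℕ} (h : n ∣ t + 1) : t % n + 1 = n := by
  have h1 : (t + 1) / n = t / n + 1 := by rw [Nat.succ_div, if_pos h]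
  have h2 := Nat.div_mul_cancel h
  have h3 := Nat.div_add_mod t n
  rw [h1, Nat.add_mul, Nat.one_mul, Nat.mul_comm] at h2
  omega

end Counting

/-! ### The scalar recursion and the choice of `ε` -/

section ErrorBound

/-- The bound for the approximation error after `m` passes through the components. -/
noncomputable def errorBound (d : ℕ) (c σ₀ : ℝ) (α : ℕ → ℝ) (m : ℕ) : ℝ :=
  c ^ m * (Real.exp (4 * ∑ j ∈ Finset.range m, α j) *
    (σ₀ + ∑ j ∈ Finset.range m, 4 * d * (α j / c ^ j)))

theorem errorBound_zero (d : ℕ) (c σ₀ : ℝ) (α : ℕ → ℝ) : errorBound d c σ₀ α 0 = σ₀ := by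
  simp [errorBound]

/-- Uses `(1 + a)⁴ ≤ exp (4a)` and `exp y - 1 ≤ y exp y`, so that the constant `d` leaves only a
term linear in `a`. -/
theorem pow_four_mul_add_sub_le {a : ℝ} (ha : 0 ≤ a) (d : ℕ) {σ : ℝ} (hσ : 0 ≤ σ) :
    (1 + a) ^ 4 * (σ + d) - d ≤ Real.exp (4 * a) * (σ + 4 * d * a) := by
  have h1 : (1 + a) ^ 4 ≤ Real.exp (4 * a) := by
    have h := Real.add_one_le_exp a
    calc (1 + a) ^ 4 ≤ Real.exp a ^ 4 := by gcongr; linarith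
      _ = Real.exp (4 * a) := by rw [← Real.exp_nat_mul]; norm_num
  have h2 : Real.exp (4 * a) - 1 ≤ Real.exp (4 * a) * (4 * a) := by
    have h := Real.add_one_le_exp (-(4 * a))
    have h' := mul_le_mul_of_nonneg_left h (Real.exp_pos (4 * a)).le
    rw [← Real.exp_add, add_neg_cancel, Real.exp_zero] at h'
    linarith
  have hd : (0 : ℝ) ≤ d := Nat.cast_nonneg d
  have h3 := mul_le_mul_of_nonneg_right h1 (add_nonneg hσ hd)
  have h4 := mul_le_mul_of_nonneg_right h2 hd
  linarith

theorem errorBound_succ {d : ℕ} {c σ₀ : ℝ} (hc : 0 < c) {α : ℕ → ℝ}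
    (hα : ∀ k, 0 ≤ α k) {m : ℕ} {σ : ℝ} (h0 : 0 ≤ σ) (h : σ ≤ errorBound d c σ₀ α m) :
    c * ((1 + α m) ^ 4 * (σ + d) - d) ≤ errorBound d c σ₀ α (m + 1) := by
  set E := Real.exp (4 * ∑ j ∈ Finset.range m, α j) with hE
  set T := ∑ j ∈ Finset.range m, 4 * d * (α j / c ^ j) with hT
  have hE1 : 1 ≤ E := Real.one_le_exp (by
    have := Finset.sum_nonneg fun j (_ : j ∈ Finset.range m) => hα j
    linarith)
  have hm : 0 ≤ 4 * d * α m := by have := hα m; positivity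
  have e : errorBound d c σ₀ α (m + 1) =
      c * (Real.exp (4 * α m) * (c ^ m * (E * (σ₀ + T)) + E * (4 * d * α m))) := by
    rw [errorBound, Finset.sum_range_succ, Finset.sum_range_succ, mul_add 4, Real.exp_add, ← hE,
      ← hT]
    field_simp
    ring
  rw [e]
  refine mul_le_mul_of_nonneg_left ((pow_four_mul_add_sub_le (hα m) d h0).trans ?_) hc.le
  refine mul_le_mul_of_nonneg_left ?_ (Real.exp_pos _).le
  rw [errorBound] at h
  -- The new summand enters `errorBound` multiplied by the accumulated exponential `E`, which only
  -- enlarges the bound.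
  have : 1 * (4 * d * α m) ≤ E * (4 * d * α m) := mul_le_mul_of_nonneg_right hE1 hm
  linarith

theorem sum_geometric_le {r : ℝ} (h0 : 0 ≤ r) (h1 : r < 1) (m : ℕ) :
    ∑ j ∈ Finset.range m, r ^ j ≤ (1 - r)⁻¹ := by
  rw [← tsum_geometric_of_lt_one h0 h1]
  exact (summable_geometric_of_lt_one h0 h1).sum_le_tsum _ fun j _ => pow_nonneg h0 j

theorem errorBound_le_delta {d : ℕ} {μ L L' ε ρ σ₀ : ℝ} (hM : 0 ≤ selfConc μ L') (hε : 0 ≤ ε)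
    (hρ0 : 0 < ρ) (hρ1 : ρ < 1 - μ / (d * L)) (hc : 1 - μ / (d * L) ≤ 1) (hσ₀ : 0 ≤ σ₀) (m : ℕ) :
    errorBound d (1 - μ / (d * L)) σ₀ (alpha μ L L' ε ρ) m ≤
      (1 - μ / (d * L)) ^ m * delta d μ L L' ε ρ σ₀ := by
  set c := 1 - μ / (d * L)
  have hc0 : 0 < c := hρ0.trans hρ1
  have h1 := sum_geometric_le hρ0.le (hρ1.trans_le hc) m
  have h2 := sum_geometric_le (div_nonneg hρ0.le hc0.le) ((div_lt_one hc0).2 hρ1) m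
  have hA : 0 ≤ selfConc μ L' * √L * ε := by positivity
  have e1 : 4 * ∑ j ∈ Finset.range m, alpha μ L L' ε ρ j ≤
      4 * selfConc μ L' * √L * ε / (1 - ρ) := by
    simp only [alpha, ← Finset.mul_sum]
    calc 4 * (selfConc μ L' * √L * ε * ∑ j ∈ Finset.range m, ρ ^ j)
        ≤ 4 * (selfConc μ L' * √L * ε * (1 - ρ)⁻¹) := by gcongr
      _ = _ := by ring
  have e2 : ∑ j ∈ Finset.range m, 4 * d * (alpha μ L L' ε ρ j / c ^ j) ≤
      ε * (4 * selfConc μ L' * d * √L / (1 - ρ / c)) := by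
    have : ∀ j, 4 * d * (alpha μ L L' ε ρ j / c ^ j) =
        4 * d * (selfConc μ L' * √L * ε) * (ρ / c) ^ j := fun j => by
      rw [alpha, div_pow]; ring
    simp only [this, ← Finset.mul_sum]
    calc 4 * d * (selfConc μ L' * √L * ε) * ∑ j ∈ Finset.range m, (ρ / c) ^ j
        ≤ 4 * d * (selfConc μ L' * √L * ε) * (1 - ρ / c)⁻¹ := by gcongr
      _ = _ := by ring
  have e3 : 0 ≤ ∑ j ∈ Finset.range m, 4 * d * (alpha μ L L' ε ρ j / c ^ j) :=
    Finset.sum_nonneg fun j _ => by rw [alpha]; positivity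
  rw [errorBound, delta]
  gcongr

theorem delta_nonneg {d : ℕ} {μ L L' ε ρ σ₀ : ℝ} (hM : 0 ≤ selfConc μ L') (hε : 0 ≤ ε)
    (hρ0 : 0 < ρ) (hρ1 : ρ < 1 - μ / (d * L)) (hσ₀ : 0 ≤ σ₀) :
    0 ≤ delta d μ L L' ε ρ σ₀ := by
  have : 0 ≤ 1 - ρ / (1 - μ / (d * L)) :=
    sub_nonneg.2 ((div_le_one (hρ0.trans hρ1)).2 hρ1.le)
  rw [delta]
  positivity

/-- The right side equals `L' √(L / μ)`. This is what makes `α k` dominate `L' R k / μ`. -/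
theorem le_selfConc_mul {μ L L' : ℝ} (hμ : 0 < μ) (hμL : μ ≤ L) (hL' : 0 ≤ L') :
    L' ≤ selfConc μ L' * √L * μ := by
  have e : μ ^ (3 / 2 : ℝ) = μ * √μ := by
    rw [Real.sqrt_eq_rpow, ← Real.rpow_one_add' hμ.le (by norm_num)]
    norm_num
  have hs : 0 < √μ := Real.sqrt_pos.2 hμ
  have hsL : √μ ≤ √L := Real.sqrt_le_sqrt hμL
  rw [selfConc, e]
  have : L' / (μ * √μ) * √L * μ = L' * √L / √μ := by field_simp
  rw [this, le_div_iff₀ hs]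
  gcongr

/-- For small starting errors, one step of the method contracts with factor `ρ`. -/
theorem exists_radius (d : ℕ) {μ L L' ρ : ℝ} (hμ : 0 < μ) (hρ0 : 0 < ρ) :
    ∃ ε > 0, L * ((1 + alpha μ L L' ε ρ 0) ^ 2 * (delta d μ L L' ε ρ ε + d) - d) + L' * ε ≤
      ρ * μ := by
  have hcont : Continuous fun ε : ℝ =>
      L * ((1 + alpha μ L L' ε ρ 0) ^ 2 * (delta d μ L L' ε ρ ε + d) - d) + L' * ε := by
    unfold alpha delta
    fun_prop
  -- At `ε = 0` both `alpha` and `delta` vanish, so the left side is `0`; continuity does the rest.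
  have h0 : L * ((1 + alpha μ L L' 0 ρ 0) ^ 2 * (delta d μ L L' 0 ρ 0 + d) - d) + L' * 0 <
      ρ * μ := by
    simpa [alpha, delta] using mul_pos hρ0 hμ
  have hev := (hcont.tendsto 0).eventually (gt_mem_nhds h0)
  obtain ⟨ε, hε, hpos⟩ := ((hev.filter_mono nhdsWithin_le_nhds).and
    (self_mem_nhdsWithin : Set.Ioi (0 : ℝ) ∈ nhdsWithin 0 (Set.Ioi 0))).exists
  exact ⟨ε, hpos, hε.le⟩

end ErrorBound

/-! ### One iteration and the invariant of a pass -/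

section Iteration

variable {d n : ℕ} {f : Fin n → EuclideanSpace ℝ (Fin d) → ℝ} {μ L L' : ℝ}

theorem sigma_smul {B K : Matrix (Fin d) (Fin d) ℝ} (hK : K.PosDef) (c : ℝ) :
    sigma (c • B) K = c * (sigma B K + d) - d := by
  rw [sigma_eq_trace hK, sigma_eq_trace hK, Matrix.mul_smul, trace_smul, smul_eq_mul,
    sub_add_cancel]

theorem app_add (A : Matrix (Fin d) (Fin d) ℝ) (u v : EuclideanSpace ℝ (Fin d)) :
    app A (u + v) = app A u + app A v := map_add _ u v

theorem app_sub (A : Matrix (Fin d) (Fin d) ℝ) (u v : EuclideanSpace ℝ (Fin d)) :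
    app A (u - v) = app A u - app A v := map_sub _ u v

theorem sub_app (A B : Matrix (Fin d) (Fin d) ℝ) (v : EuclideanSpace ℝ (Fin d)) :
    app (A - B) v = app A v - app B v := by
  simp [app, map_sub]

theorem sum_app (A : Fin n → Matrix (Fin d) (Fin d) ℝ) (v : EuclideanSpace ℝ (Fin d)) :
    app (∑ i, A i) v = ∑ i, app (A i) v := by
  simp [app, map_sum]

theorem norm_step_sub_le [NeZero n] (hμ : 0 < μ) (hL : 0 < L) (hL' : 0 ≤ L')
    (hf : ∀ i, ContDiff ℝ 2 (f i)) (hconv : ∀ i, StrongConvexSmooth μ L (f i))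
    (hlip : ∀ i, LipschitzHessian L' (f i)) {xstar : EuclideanSpace ℝ (Fin d)}
    (hstar : ∑ i, ∇ (f i) xstar = 0) {z : Fin n → EuclideanSpace ℝ (Fin d)}
    {D : Fin n → Matrix (Fin d) (Fin d) ℝ} {s r ε ρ : ℝ} (hr : 0 ≤ r) (hrε : r ≤ ε)
    (hD : ∀ i, hess (f i) (z i) ≤ D i) (hs : ∀ i, sigma (D i) (hess (f i) (z i)) ≤ s)
    (hz : ∀ i, ‖z i - xstar‖ ≤ r) (hρ : L * s + L' * ε ≤ ρ * μ) :
    ‖app (∑ i, D i)⁻¹ (∑ i, (app (D i) (z i) - ∇ (f i) (z i))) - xstar‖ ≤ ρ * r := by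
  have hn : (0 : ℝ) < n := by exact_mod_cast NeZero.pos n
  have hDμ : ∀ i, μ • 1 ≤ D i := fun i => (smul_one_le_hess (hf i) (hconv i) (z i)).trans (hD i)
  have hsum : (n * μ) • (1 : Matrix (Fin d) (Fin d) ℝ) ≤ ∑ i, D i := by
    calc (n * μ) • (1 : Matrix (Fin d) (Fin d) ℝ)
        = ∑ _i : Fin n, μ • (1 : Matrix (Fin d) (Fin d) ℝ) := by
          rw [Finset.sum_const, Finset.card_univ, Fintype.card_fin, mul_smul, Nat.cast_smul_eq_nsmul]
      _ ≤ _ := Finset.sum_le_sum fun i _ => hDμ i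
  have hpos : 0 < n * μ := by positivity
  have hSd := posDef_of_le (posDef_smul_one hpos) hsum
  set e : Fin n → EuclideanSpace ℝ (Fin d) := fun i =>
    app (D i - hess (f i) (z i)) (z i - xstar) +
      (app (hess (f i) (z i)) (z i - xstar) - (∇ (f i) (z i) - ∇ (f i) xstar)) with he
  have heq : app (∑ i, D i)⁻¹ (∑ i, (app (D i) (z i) - ∇ (f i) (z i))) - xstar =
      app (∑ i, D i)⁻¹ (∑ i, e i) := by
    have : ∑ i, (app (D i) (z i) - ∇ (f i) (z i)) = ∑ i, e i + app (∑ i, D i) xstar := by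
      -- The subtracted zero is rewritten as the sum of the gradients at `xstar`.
      rw [sum_app, ← Finset.sum_add_distrib, ← sub_zero (∑ i, (e i + app (D i) xstar)), ← hstar,
        ← Finset.sum_sub_distrib]
      refine Finset.sum_congr rfl fun i _ => ?_
      simp only [he, sub_app, app_sub]
      abel
    rw [this, app_add, app_inv_self hSd, add_sub_cancel_right]
  have hei : ∀ i, ‖e i‖ ≤ ρ * μ * r := fun i => by
    have hH := posDef_of_le (posDef_smul_one hμ) (smul_one_le_hess (hf i) (hconv i) (z i))
    have h1 := norm_app_le_trace (Matrix.le_iff.mp (hD i)) (z i - xstar)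
    have h2 := norm_app_hess_sub_gradient_le hL' (hf i) (hlip i) xstar (z i)
    have h3 := trace_sub_le_mul_sigma hL hH (hess_le_smul_one (hf i) (hconv i) (z i)) (hD i)
    have h4 := sigma_nonneg hH (hD i)
    calc ‖e i‖ ≤ _ := norm_add_le _ _
      _ ≤ (D i - hess (f i) (z i)).trace * ‖z i - xstar‖ + L' * ‖z i - xstar‖ ^ 2 :=
        add_le_add h1 h2
      _ ≤ (L * s) * r + L' * (ε * r) := by
        gcongr
        · exact mul_nonneg hL.le (h4.trans (hs i))
        · exact h3.trans (mul_le_mul_of_nonneg_left (hs i) hL.le)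
        · exact hz i
        · rw [pow_two]
          exact mul_le_mul ((hz i).trans hrε) (hz i) (norm_nonneg _) (hr.trans hrε)
      _ = (L * s + L' * ε) * r := by ring
      _ ≤ ρ * μ * r := by gcongr
  have hfin := mul_norm_app_inv_le hpos hsum (∑ i, e i)
  have hnorm : ‖∑ i, e i‖ ≤ n * (ρ * μ * r) := by
    calc ‖∑ i, e i‖ ≤ ∑ i, ‖e i‖ := norm_sum_le _ _
      _ ≤ ∑ _i : Fin n, ρ * μ * r := Finset.sum_le_sum fun i _ => hei i
      _ = _ := by simp
  rw [heq]
  refine le_of_mul_le_mul_left ?_ hpos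
  linarith

/-- `B` is an upper approximation of the Hessian at `z`, with error at most `s`, and `z` has
distance at most `r` from `xstar`. -/
structure Tracks (g : EuclideanSpace ℝ (Fin d) → ℝ) (xstar : EuclideanSpace ℝ (Fin d)) (s r : ℝ)
    (z : EuclideanSpace ℝ (Fin d)) (B : Matrix (Fin d) (Fin d) ℝ) : Prop where
  hess_le : hess g z ≤ B
  sigma_le : sigma B (hess g z) ≤ s
  norm_le : ‖z - xstar‖ ≤ r

/-- One update of a component, from the state after `k` passes to the state after `k + 1`. -/
theorem Tracks.update {g : EuclideanSpace ℝ (Fin d) → ℝ} {xstar : EuclideanSpace ℝ (Fin d)}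
    (hμ : 0 < μ) (hL : 0 < L) (hd : 0 < d) (hL' : 0 ≤ L') (hg : ContDiff ℝ 2 g)
    (hconv : StrongConvexSmooth μ L g) (hlip : LipschitzHessian L' g)
    (hc : 0 ≤ 1 - μ / (d * L)) {a s s' r r' : ℝ} (ha : 0 ≤ a) (hr : r' ≤ r) (har : L' * r ≤ a * μ)
    (hs : ∀ σ, 0 ≤ σ → σ ≤ s → (1 - μ / (d * L)) * ((1 + a) ^ 4 * (σ + d) - d) ≤ s')
    {z z' u : EuclideanSpace ℝ (Fin d)} {B : Matrix (Fin d) (Fin d) ℝ}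
    (h : Tracks g xstar s r z B) (hz' : ‖z' - xstar‖ ≤ r')
    (hu : IsGreedyVec (bfgs ((1 + a) ^ 2 • B) ((1 + a) • avgHess g z z') (z' - z))
      (hess g z') u) :
    Tracks g xstar s' r' z'
      (bfgs (bfgs ((1 + a) ^ 2 • B) ((1 + a) • avgHess g z z') (z' - z)) (hess g z') u) := by
  have hdist : ‖z' - z‖ ≤ 2 * r := by
    have := norm_sub_le (z' - xstar) (z - xstar)
    rw [sub_sub_sub_cancel_right] at this
    linarith [h.norm_le]
  have hcμ : L' * ‖z' - z‖ / 2 ≤ a * μ := by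
    have := mul_le_mul_of_nonneg_left hdist hL'
    linarith
  obtain ⟨h1, h2⟩ := hess_avgHess_le hg hconv hlip ha z z' hcμ
  obtain ⟨h3, h4⟩ := hess_avgHess_le hg hconv hlip ha z' z (by rwa [norm_sub_rev])
  rw [avgHess_comm] at h3 h4
  have hH := posDef_of_le (posDef_smul_one hμ) (smul_one_le_hess hg hconv z)
  have hH' := posDef_of_le (posDef_smul_one hμ) (smul_one_le_hess hg hconv z')
  have hK := posDef_of_le (posDef_smul_one hμ) (smul_one_le_avgHess hg hconv z z')
  obtain ⟨hle, hσ⟩ := le_and_sigma_bfgs_le ha hH hH' hK h.hess_le h1 h2 h3 h4 (z' - z)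
  refine ⟨le_bfgs hH' hle u, ?_, hz'⟩
  exact (sigma_bfgs_greedy_le hμ hL hd (smul_one_le_hess hg hconv z')
    (hess_le_smul_one hg hconv z') hle hu).trans
    ((mul_le_mul_of_nonneg_left hσ hc).trans (hs _ (sigma_nonneg hH h.hess_le) h.sigma_le))

/-- The state of the method after `t` iterations: the first `t % n` components have already been
updated in the current pass, the other ones carry the scaling factor of that pass. -/
def PassInvariant (f : Fin n → EuclideanSpace ℝ (Fin d) → ℝ) (xstar : EuclideanSpace ℝ (Fin d))
    (α S R : ℕ → ℝ) (z : ℕ → Fin n → EuclideanSpace ℝ (Fin d))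
    (D : ℕ → Fin n → Matrix (Fin d) (Fin d) ℝ) (t : ℕ) : Prop :=
  ∀ i : Fin n,
    (i.val < t % n → Tracks (f i) xstar (S (t / n + 1)) (R (t / n + 1)) (z t i) (D t i)) ∧
    (t % n ≤ i.val → ∃ B, D t i = (1 + α (t / n)) ^ 2 • B ∧
      Tracks (f i) xstar (S (t / n)) (R (t / n)) (z t i) B)

variable {α S R : ℕ → ℝ} {I₀ : Fin n → Matrix (Fin d) (Fin d) ℝ}
  {x : ℕ → EuclideanSpace ℝ (Fin d)} {z : ℕ → Fin n → EuclideanSpace ℝ (Fin d)}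
  {D : ℕ → Fin n → Matrix (Fin d) (Fin d) ℝ} {xstar : EuclideanSpace ℝ (Fin d)}

theorem IsRun.passInvariant_zero [NeZero n] (hrun : IsRun f α I₀ x z D)
    (hI : ∀ i, hess (f i) (x 0) ≤ I₀ i) (hσ : ∀ i, sigma (I₀ i) (hess (f i) (x 0)) ≤ S 0)
    (hR : ‖x 0 - xstar‖ ≤ R 0) : PassInvariant f xstar α S R z D 0 := by
  refine fun i => ⟨fun h => ?_, fun _ => ⟨I₀ i, ?_, ?_⟩⟩
  · simp at h
  · rw [Nat.zero_div]; exact hrun.D_zero i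
  · rw [Nat.zero_div, hrun.z_zero]
    exact ⟨hI i, hσ i, hR⟩

theorem omega_succ [NeZero n] (t : ℕ) :
    omega n α (t + 1) = if n ∣ t + 1 then (1 + α (t / n + 1)) ^ 2 else 1 := by
  rw [omega, ceil_succ_div]

/-- Passing to the next iteration, in terms of the unscaled matrices `B i`. -/
theorem passInvariant_succ [NeZero n] {t : ℕ} {B : Fin n → Matrix (Fin d) (Fin d) ℝ}
    (hD : ∀ i : Fin n, i.val ≤ t % n → D (t + 1) i = omega n α (t + 1) • B i ∧
      Tracks (f i) xstar (S (t / n + 1)) (R (t / n + 1)) (z (t + 1) i) (B i))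
    (hD' : ∀ i : Fin n, t % n < i.val → ∃ C,
      D (t + 1) i = omega n α (t + 1) • (1 + α (t / n)) ^ 2 • C ∧
      Tracks (f i) xstar (S (t / n)) (R (t / n)) (z (t + 1) i) C) :
    PassInvariant f xstar α S R z D (t + 1) := by
  intro i
  rw [omega_succ] at hD hD'
  by_cases hdvd : n ∣ t + 1
  -- The pass ends: every index is at most `t % n = n - 1`, so all components have been updated, and
  -- `omega` supplies the scaling of the next pass.
  · have hmod := mod_add_one_of_dvd hdvd
    rw [Nat.succ_div, if_pos hdvd, Nat.mod_eq_zero_of_dvd hdvd]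
    rw [if_pos hdvd] at hD
    exact ⟨fun h => absurd h (Nat.not_lt_zero _), fun _ => ⟨B i, hD i (by omega)⟩⟩
  · rw [Nat.succ_div, if_neg hdvd, add_zero, mod_succ_of_not_dvd hdvd]
    simp only [if_neg hdvd, one_smul] at hD hD'
    refine ⟨fun h => ?_, fun h => hD' i (by omega)⟩
    obtain ⟨h1, h2⟩ := hD i (by omega)
    rwa [h1]

theorem omega_ne_zero (hα : ∀ k, 0 ≤ α k) (t : ℕ) : omega n α t ≠ 0 := by
  unfold omega
  split_ifs
  · have := hα ⌈(t : ℝ) / n⌉₊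
    positivity
  · exact one_ne_zero

/-- All components, whether updated in this pass or not, satisfy the common bounds `s` and `R (t /
n)`, so the new point reaches radius `R (t / n + 1)`. The component with index `t % n` still has its
scaled matrix, which is exactly the input `Tracks.update` needs. -/
theorem IsRun.step [NeZero n] {ε ρ s : ℝ} (hrun : IsRun f α I₀ x z D) (hμ : 0 < μ) (hL : 0 < L)
    (hd : 0 < d) (hL' : 0 ≤ L')
    (hf : ∀ i, ContDiff ℝ 2 (f i)) (hconv : ∀ i, StrongConvexSmooth μ L (f i))
    (hlip : ∀ i, LipschitzHessian L' (f i)) (hstar : ∑ i, ∇ (f i) xstar = 0)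
    (hc : 0 ≤ 1 - μ / (d * L)) (hα : ∀ k, 0 ≤ α k)
    (hS : ∀ k σ, 0 ≤ σ → σ ≤ S k →
      (1 - μ / (d * L)) * ((1 + α k) ^ 4 * (σ + d) - d) ≤ S (k + 1))
    (hs : ∀ k, (1 + α k) ^ 2 * (S k + d) - d ≤ s) (hs' : ∀ k, S k ≤ s)
    (hR0 : ∀ k, 0 ≤ R k) (hRε : ∀ k, R k ≤ ε) (hR : ∀ k, R (k + 1) = ρ * R k)
    (hρ1 : ρ ≤ 1) (hαR : ∀ k, L' * R k ≤ α k * μ) (hρ : L * s + L' * ε ≤ ρ * μ)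
    {t : ℕ} (hinv : PassInvariant f xstar α S R z D t) :
    PassInvariant f xstar α S R z D (t + 1) ∧
      Tracks (f (idx n (t + 1))) xstar (S (t / n + 1)) (R (t / n + 1)) (x (t + 1))
        ((omega n α (t + 1))⁻¹ • D (t + 1) (idx n (t + 1))) := by
  have hH : ∀ i w, (hess (f i) w).PosDef := fun i w =>
    posDef_of_le (posDef_smul_one hμ) (smul_one_le_hess (hf i) (hconv i) w)
  have hRle : R (t / n + 1) ≤ R (t / n) := by
    rw [hR]; nlinarith [hR0 (t / n)]
  have hstate : ∀ i, hess (f i) (z t i) ≤ D t i ∧ sigma (D t i) (hess (f i) (z t i)) ≤ s ∧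
      ‖z t i - xstar‖ ≤ R (t / n) := fun i => by
    rcases lt_or_ge i.val (t % n) with h | h
    · have := (hinv i).1 h
      exact ⟨this.hess_le, this.sigma_le.trans (hs' _), this.norm_le.trans hRle⟩
    · obtain ⟨B, hB, hT⟩ := (hinv i).2 h
      have h1 : 1 ≤ (1 + α (t / n)) ^ 2 := one_le_pow₀ (by linarith [hα (t / n)])
      rw [hB]
      refine ⟨hT.hess_le.trans
        (le_smul_of_one_le (posDef_of_le (hH _ _) hT.hess_le).posSemidef h1), ?_, hT.norm_le⟩
      rw [sigma_smul (hH _ _)]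
      refine le_trans ?_ (hs (t / n))
      gcongr
      exact hT.sigma_le
  have hx : ‖x (t + 1) - xstar‖ ≤ R (t / n + 1) := by
    rw [hrun.x_update (t + 1) (by omega), hR]
    exact norm_step_sub_le hμ hL hL' hf hconv hlip hstar (hR0 _) (hRε _)
      (fun i => (hstate i).1) (fun i => (hstate i).2.1) (fun i => (hstate i).2.2) hρ
  obtain ⟨u, hu, hDu⟩ := hrun.D_update (t + 1) (by omega)
  have hz := hrun.z_update (t + 1) (by omega)
  obtain ⟨B, hB, hT⟩ := (hinv (idx n (t + 1))).2 (idx_succ_val t).ge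
  have hceil : ⌈((t + 1 : ℕ) : ℝ) / n - 1⌉₊ = t / n := by
    rw [Nat.ceil_sub_one, ceil_succ_div, Nat.add_sub_cancel]
  rw [classicUpdate, hceil, Nat.add_sub_cancel, hB] at hu hDu
  have hnew := hT.update hμ hL hd hL' (hf _) (hconv _) (hlip _) hc (hα _) hRle (hαR _) (hS _)
    (by rw [hz]; exact hx) hu
  set N := bfgs (bfgs ((1 + α (t / n)) ^ 2 • B)
    ((1 + α (t / n)) • avgHess (f (idx n (t + 1))) (z t (idx n (t + 1)))
      (z (t + 1) (idx n (t + 1)))) (z (t + 1) (idx n (t + 1)) - z t (idx n (t + 1))))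
    (hess (f (idx n (t + 1))) (z (t + 1) (idx n (t + 1)))) u
  constructor
  · refine passInvariant_succ (B := fun i => if i = idx n (t + 1) then N else D t i)
      (fun i hi => ?_) (fun i hi => ?_)
    · by_cases h : i = idx n (t + 1)
      · subst h
        simp only [if_true]
        exact ⟨hDu, hnew⟩
      · simp only [if_neg h]
        have hi' : i.val < t % n := lt_of_le_of_ne hi fun e => h (Fin.ext e)
        rw [hrun.z_keep (t + 1) (by omega) i h]
        exact ⟨hrun.D_keep (t + 1) (by omega) i h, (hinv i).1 hi'⟩
    · have h : i ≠ idx n (t + 1) := by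
        rintro rfl
        exact lt_irrefl _ (hi.trans_eq (idx_succ_val t))
      obtain ⟨C, hC, hTC⟩ := (hinv i).2 hi.le
      refine ⟨C, ?_, ?_⟩
      · rw [hrun.D_keep (t + 1) (by omega) i h, Nat.add_sub_cancel, hC]
      · rw [hrun.z_keep (t + 1) (by omega) i h]
        exact hTC
  · rw [hDu, inv_smul_smul₀ (omega_ne_zero hα _), ← hz]
    exact hnew

end Iteration

end SLIQN

/-! ### Choice of constants and conclusion -/

theorem lemma2 {d n : ℕ} [NeZero n] (hd : 0 < d)
    (f : Fin n → EuclideanSpace ℝ (Fin d) → ℝ) (μ L L' : ℝ) (hμ : 0 < μ)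
    (hf : ∀ i, ContDiff ℝ 2 (f i))
    (hconv : ∀ i, SLIQN.StrongConvexSmooth μ L (f i))
    (hlip : ∀ i, SLIQN.LipschitzHessian L' (f i))
    (xstar : EuclideanSpace ℝ (Fin d))
    (hxstar : IsMinOn (fun y => (1 / (n : ℝ)) * ∑ i, f i y) Set.univ xstar)
    (ρ : ℝ) (hρ0 : 0 < ρ) (hρ1 : ρ < 1 - μ / (d * L)) :
    ∃ ε > 0, ∃ σ₀ > 0,
      ∀ (I₀ : Fin n → Matrix (Fin d) (Fin d) ℝ) (x : ℕ → EuclideanSpace ℝ (Fin d))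
        (z : ℕ → Fin n → EuclideanSpace ℝ (Fin d)) (D : ℕ → Fin n → Matrix (Fin d) (Fin d) ℝ),
        ‖x 0 - xstar‖ ≤ ε →
        (∀ i, (I₀ i - SLIQN.hess (f i) (x 0)).PosSemidef) →
        (∀ i, SLIQN.sigma (I₀ i) (SLIQN.hess (f i) (x 0)) ≤ σ₀) →
        SLIQN.IsRun f (SLIQN.alpha μ L L' ε ρ) I₀ x z D →
        (∀ t : ℕ, ‖x t - xstar‖ ≤ ρ ^ ⌈(t : ℝ) / n⌉₊ * ‖x 0 - xstar‖) ∧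
        (∀ t : ℕ, 1 ≤ t →
          SLIQN.sigma
              ((SLIQN.omega n (SLIQN.alpha μ L L' ε ρ) t)⁻¹ • D t (SLIQN.idx n t))
              (SLIQN.hess (f (SLIQN.idx n t)) (z t (SLIQN.idx n t)))
            ≤ (1 - μ / (d * L)) ^ ⌈(t : ℝ) / n⌉₊ * SLIQN.delta d μ L L' ε ρ σ₀) := by
  have hμL : μ ≤ L := SLIQN.strongConvexSmooth_le hd (hconv 0)
  have hL : 0 < L := hμ.trans_le hμL
  have hL' : 0 ≤ L' := SLIQN.lipschitzHessian_nonneg hd (hlip 0)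
  have hM : 0 ≤ SLIQN.selfConc μ L' := div_nonneg hL' (Real.rpow_nonneg hμ.le _)
  have hc1 : 1 - μ / (d * L) ≤ 1 := by
    have : 0 ≤ μ / (d * L) := by positivity
    linarith
  have hc0 : 0 < 1 - μ / (d * L) := hρ0.trans hρ1
  have hρle : ρ ≤ 1 := hρ1.le.trans hc1
  obtain ⟨ε, hε, hεle⟩ := SLIQN.exists_radius d (L := L) (L' := L') hμ hρ0
  -- A single small parameter serves as both `ε` and `σ₀`.
  refine ⟨ε, hε, ε, hε, fun I₀ x z D hx0 hI hσ hrun => ?_⟩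
  set α := SLIQN.alpha μ L L' ε ρ with hαdef
  set S := SLIQN.errorBound d (1 - μ / (d * L)) ε α with hSdef
  set R : ℕ → ℝ := fun k => ρ ^ k * ‖x 0 - xstar‖ with hRdef
  have hα : ∀ k, 0 ≤ α k := fun k => by
    rw [hαdef, SLIQN.alpha]; positivity
  have hα0 : ∀ k, α k ≤ α 0 := fun k => by
    simp only [hαdef, SLIQN.alpha]
    gcongr 1
    rw [pow_zero]
    exact pow_le_one₀ hρ0.le hρle
  have hδ := SLIQN.delta_nonneg (L' := L') hM hε.le hρ0 hρ1 hε.le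
  have hSδ : ∀ k, S k ≤ (1 - μ / (d * L)) ^ k * SLIQN.delta d μ L L' ε ρ ε :=
    SLIQN.errorBound_le_delta hM hε.le hρ0 hρ1 hc1 hε.le
  have hSδ' : ∀ k, S k ≤ SLIQN.delta d μ L L' ε ρ ε := fun k =>
    (hSδ k).trans (mul_le_of_le_one_left hδ (pow_le_one₀ hc0.le hc1))
  have hRε : ∀ k, R k ≤ ρ ^ k * ε := fun k => by
    simp only [hRdef]; gcongr
  have hstep := fun t => hrun.step (xstar := xstar) (S := S) (R := R) (ε := ε) (ρ := ρ)
    -- This is the error after scaling, computed from the uniform bounds `S k ≤ δ` and `α k ≤ α 0`;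
    -- it is the quantity made small by `exists_radius`.
    (s := (1 + α 0) ^ 2 * (SLIQN.delta d μ L L' ε ρ ε + d) - d) hμ hL hd hL' hf hconv hlip
    (SLIQN.sum_gradient_eq_zero hf hxstar) hc0.le hα
    (fun k σ h0 h => SLIQN.errorBound_succ hc0 hα h0 h)
    (fun k => by
      have h1 : (0 : ℝ) ≤ d := Nat.cast_nonneg d
      have h2 : (1 + α k) ^ 2 ≤ (1 + α 0) ^ 2 := by
        have := hα k
        gcongr
        exact hα0 k
      calc _ ≤ (1 + α k) ^ 2 * (SLIQN.delta d μ L L' ε ρ ε + d) - d := by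
            gcongr
            exact hSδ' k
        _ ≤ _ := by gcongr)
    (fun k => by
      have h1 : (0 : ℝ) ≤ d := Nat.cast_nonneg d
      have h2 : 1 ≤ (1 + α 0) ^ 2 := one_le_pow₀ (by linarith [hα 0])
      have h3 := mul_le_mul_of_nonneg_right h2 (add_nonneg hδ h1)
      linarith [hSδ' k])
    (fun k => by simp only [hRdef]; positivity)
    (fun k => (hRε k).trans (mul_le_of_le_one_left hε.le (pow_le_one₀ hρ0.le hρle)))
    (fun k => by simp only [hRdef, pow_succ]; ring)
    hρle
    (fun k => by
      have h1 := SLIQN.le_selfConc_mul hμ hμL hL'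
      calc L' * R k ≤ (SLIQN.selfConc μ L' * √L * μ) * (ρ ^ k * ε) := by
            gcongr
            exact hRε k
        _ = α k * μ := by rw [hαdef, SLIQN.alpha]; ring)
    hεle (t := t)
  have hinv : ∀ t, SLIQN.PassInvariant f xstar α S R z D t := fun t => by
    induction t with
    | zero =>
      refine hrun.passInvariant_zero (fun i => Matrix.le_iff.mpr (hI i)) ?_ ?_
      · rw [hSdef, SLIQN.errorBound_zero]; exact hσ
      · simp [hRdef]
    | succ t ih => exact (hstep t ih).1
  constructor
  · rintro (_ | t)
    · simp
    · rw [SLIQN.ceil_succ_div]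
      exact (hstep t (hinv t)).2.norm_le
  · rintro (_ | t) ht
    · omega
    · rw [SLIQN.ceil_succ_div, hrun.z_update (t + 1) ht]
      exact (hstep t (hinv t)).2.sigma_le.trans (hSδ _)
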